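/- Let $E$ be a finite-dimensional real inner product space, $n\ge 1$, and let $F_1,\dots,F_n:E\to E$ be operators with average $F=\frac1n\sum_{i=1}^nF_i$ (for instance $E=\mathbb R^{d_1+d_2}$ and $F_i=(\nabla_x f_i,-\nabla_y f_i)$, the saddle gradients of the components of $\min_x\max_y\frac1n\sum_i f_i(x,y)$). Let $L>0$ and $M,\rho,\sigma\ge 0$, and suppose that: * each $F_i$ is $L$-Lipschitz and differentiable, and its derivative $DF_i$ is $M$-Lipschitz in operator norm; * $\frac1n\sum_{i=1}^n\|F_iz-Fz\|^2\le(\rho\|Fz\|+\sigma)^2$ for all $z\in E$; * $z^*\in E$ satisfies $Fz^*=0$, and $F$ is star-monotone: $\langle Fz,z-z^*\rangle\ge 0$ for all $z\in E$ (in particular, this holds if $F$ is monotone). *Algorithm.* SEG-FFA with stepsizes $(\eta_k)_{k\ge 0}$ starts from a given point $z_0^0=z^0\in E$. In epoch $k=0,1,\dots$ it draws a uniformly random permutation $\tau_k$ of $\{1,\dots,n\}$, independently of the other epochs, and for $i=0,\dots,2n-1$ sets $$w_i^k=z_i^k-\alpha_kF_{j(i)}z_i^k,\qquad z_{i+1}^k=z_i^k-\beta_kF_{j(i)}w_i^k,\qquad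 \beta_k=\eta_k,\quad \alpha_k=\eta_k/2,$$ where $j(i)=\tau_k(i+1)$ for $i<n$ and $j(i)=\tau_k(2n-i)$ for $i\ge n$. Then $z_0^{k+1}=\frac12(z_0^k+z_{2n}^k)$. Write $z^k=z_0^k$. The stepsizes are $$\eta_k=\frac{\eta_0\,\sqrt[3]{2}\,\log 2}{(k+2)^{1/3}\log(k+2)},\qquad k=0,1,\dots,\qquad \eta_0>0.$$ *Constants.* Put $a=\frac12\left(1+\frac{2e^2}{3}\right)+\frac{6+e^2}{3}$, $b=\frac{83}{4}+\frac{24e^4}{5}$, $c=\frac{243}{16}+27e^4$, and $$C_1=L^2(a+15\rho),\quad D_1=M(b+\rho^2c),\quad V_1=M\sigma^2c+15L^2\sigma,$$ $$C_2=4L^4(a^2+36\rho^2e^4),\quad D_2=4M^2(b^2+\rho^4c^2),\quad V_2=4M^2\sigma^4c^2+144e^4L^4\sigma^2,$$ $$S=\sum_{k=0}^\infty\eta_k^3n^3L^3,\qquad R=e^S\left(\|z^0-z^*\|^2+\frac{6SV_1^2}{L^6}\right).$$ Call $(\eta_0,\lambda)$ with $\eta_0,\lambda>0$ admissible if $$\eta_0^2n^2L^2+\frac{3\eta_0nC_1^2}{L^3}+\frac{3\eta_0nD_1^2}{L}R\le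 1\qquad\text{and}\qquad \eta_0^2n^2L^2+\frac{\eta_0nC_2}{L^3}+\frac{\eta_0nD_2}{L}R\le 1-\lambda .$$ *Claim.* For all sufficiently small $\eta_0>0$ there is $\lambda>0$ such that $(\eta_0,\lambda)$ is admissible. For every admissible $(\eta_0,\lambda)$, the iterates of SEG-FFA satisfy $\mathbb E\|Fz^k\|^2<\infty$ for all $k$, and for every $K\ge 1$ $$\min_{k=0,\dots,K}\mathbb E\|Fz^k\|^2\le\frac{(\log(K+3))^2}{(K+3)^{1/3}}\cdot\frac{\|z^0-z^*\|^2+\frac{3V_2}{nL^6}}{\lambda e^{-3/2}(\sqrt[3]{2}\log 2)^2\,\eta_0^2n^2},$$ so that $\min_{k\le K}\mathbb E\|Fz^k\|^2=O\left((\log K)^2/K^{1/3}\right)$ as $K\to\infty$. The same conclusions hold for any sequence of random vectors $z^0,z^1,\dots$ starting almost surely at the given initial point such that, for all $k$, the errors $r^k=z^{k+1}-\left(z^k-\eta_knF(z^k-\eta_knFz^k)\right)$ satisfy, almost surely, $$\|r^k\|\le\eta_k^3n^3\left(C_1\|Fz^k\|+D_1\|Fz^k\|^2+V_1\right),\qquad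 \mathbb E\left[\|r^k\|^2\mid z^k\right]\le\eta_k^6n^6C_2\|Fz^k\|^2+\eta_k^6n^6D_2\|Fz^k\|^4+\eta_k^6n^5V_2 .$$ -/

import Mathlib

open MeasureTheory ProbabilityTheory Filter Asymptotics

noncomputable section

namespace SEGFFA

section Operators

variable {E : Type*} [NormedAddCommGroup E] [InnerProductSpace ℝ E]

/-- The full operator `F = (1/n) ∑ i, F i` of a finite family of component operators. -/
def fullOp {n : ℕ} (F : Fin n → E → E) (z : E) : E := (n : ℝ)⁻¹ • ∑ i, F i z

/-- Monotonicity of an operator. -/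
def IsMonotoneOp (G : E → E) : Prop := ∀ z w, 0 ≤ inner ℝ (G z - G w) (z - w)

/-- Star-monotonicity of an operator with respect to the point `zs`
(which in every use is a zero of the operator). -/
def IsStarMonotone (G : E → E) (zs : E) : Prop := ∀ z, 0 ≤ inner ℝ (G z) (z - zs)

/-- A monotone operator is star-monotone with respect to each of its zeros. -/
theorem IsMonotoneOp.isStarMonotone {G : E → E} (hG : IsMonotoneOp G) {zs : E} (hzs : G zs = 0) :
    IsStarMonotone G zs := fun z => by
  have h := hG z zs
  rwa [hzs, sub_zero] at h

/-- `G` is `L`-Lipschitz, differentiable, and its derivative is `M`-Lipschitz (operator norm). -/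
structure IsSmoothOp (L M : ℝ) (G : E → E) : Prop where
  lipschitz : ∀ z w, ‖G z - G w‖ ≤ L * ‖z - w‖
  differentiable : Differentiable ℝ G
  lipschitz_fderiv : ∀ z w, ‖fderiv ℝ G z - fderiv ℝ G w‖ ≤ M * ‖z - w‖

/-- The component variance bound with constants `ρ` and `σ`. -/
def HasComponentVariance {n : ℕ} (F : Fin n → E → E) (ρ σ : ℝ) : Prop :=
  ∀ z, (n : ℝ)⁻¹ * ∑ i, ‖F i z - fullOp F z‖ ^ 2 ≤ (ρ * ‖fullOp F z‖ + σ) ^ 2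

/-! ### The algorithm -/

/-- One same-sample stochastic extragradient step:
`w = z - α G z`, and the new point is `z - β G w`. -/
def segStep (α β : ℝ) (G : E → E) (z : E) : E := z - β • G (z - α • G z)

/-- The operator used in iteration `i` of an epoch of length `2 n` with flip-flop sampling.
With zero-based indices, it is `F (π i)` for `i = 0, …, n - 1` and `F (π (2 n - 1 - i))` for
`i = n, …, 2 n - 1`. -/
def flipFlopOp {n : ℕ} [NeZero n] (F : Fin n → E → E) (π : Equiv.Perm (Fin n)) (i : ℕ) : E → E :=
  if i < n then F (π (Fin.ofNat n i)) else F (π (Fin.ofNat n (2 * n - 1 - i)))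

/-- The iterates `z_0, z_1, z_2, …` inside an epoch. -/
def innerIterate {n : ℕ} [NeZero n] (F : Fin n → E → E) (π : Equiv.Perm (Fin n)) (α β : ℝ)
    (z : E) : ℕ → E
  | 0 => z
  | i + 1 => segStep α β (flipFlopOp F π i) (innerIterate F π α β z i)

/-- One epoch of SEG-FFA: `2 n` flip-flop steps followed by the anchoring step. -/
def epoch {n : ℕ} [NeZero n] (F : Fin n → E → E) (π : Equiv.Perm (Fin n)) (α β : ℝ) (z : E) : E :=
  (1 / 2 : ℝ) • (z + innerIterate F π α β z (2 * n))

/-- The initial points `z_0^k` of the epochs of SEG-FFA, run with `α_k = η_k / 2`, `β_k = η_k`,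
from the initial point `z0`, when `τ k` is the permutation drawn in epoch `k`. -/
def segFFA {n : ℕ} [NeZero n] (F : Fin n → E → E) (η : ℕ → ℝ) (z0 : E)
    (τ : ℕ → Equiv.Perm (Fin n)) : ℕ → E
  | 0 => z0
  | k + 1 => epoch F (τ k) (η k / 2) (η k) (segFFA F η z0 τ k)

/-- The within-epoch error of an update from `z` to `z'` with stepsize `η`: the difference
between `z'` and the result of a deterministic extragradient step with stepsize `η n`. -/
def epochError {n : ℕ} (F : Fin n → E → E) (η : ℝ) (z z' : E) : E :=
  z' - (z - (η * n) • fullOp F (z - (η * n) • fullOp F z))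

end Operators

/-! ### Random permutations -/

/-- The finite set of permutations carries the discrete σ-algebra. -/
instance instMeasurableSpacePerm (n : ℕ) : MeasurableSpace (Equiv.Perm (Fin n)) := ⊤

/-- `τ 0, τ 1, …` are independent and uniformly distributed random permutations. -/
structure IsUniformShuffle {Ω : Type*} [MeasurableSpace Ω] (P : Measure Ω) {n : ℕ}
    (τ : ℕ → Ω → Equiv.Perm (Fin n)) : Prop where
  measurable : ∀ k, Measurable (τ k)
  indep : iIndepFun τ P
  uniform : ∀ k π, P (τ k ⁻¹' {π}) = ((Nat.factorial n : ℕ) : ENNReal)⁻¹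

/-- `min_{k = 0, …, K} 𝔼 ‖G (z k)‖²`. -/
def minExpectedSqNorm {Ω E : Type*} [MeasurableSpace Ω] [NormedAddCommGroup E] (P : Measure Ω)
    (G : E → E) (z : ℕ → Ω → E) (K : ℕ) : ℝ :=
  (Finset.range (K + 1)).inf' Finset.nonempty_range_add_one fun k => ∫ ω, ‖G (z k ω)‖ ^ 2 ∂P

/-! ### Stepsizes and constants -/

/-- `η_k = η₀ 2^(1/3) log 2 / ((k + 2)^(1/3) log (k + 2))`. -/
def stepsize (η₀ : ℝ) (k : ℕ) : ℝ :=
  η₀ * (2 : ℝ) ^ (1 / 3 : ℝ) * Real.log 2 /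
    (((k : ℝ) + 2) ^ (1 / 3 : ℝ) * Real.log ((k : ℝ) + 2))

def C1A (L ρ : ℝ) : ℝ :=
  L ^ 2 * (1 / 2 * (1 + 2 * Real.exp 2 / 3) + (6 + Real.exp 2) / 3 + 15 * ρ)

def D1A (M ρ : ℝ) : ℝ :=
  M * (83 / 4 + 24 * Real.exp 4 / 5 + ρ ^ 2 * (243 / 16 + 27 * Real.exp 4))

def V1A (L M σ : ℝ) : ℝ :=
  M * σ ^ 2 * (243 / 16 + 27 * Real.exp 4) + 15 * L ^ 2 * σ

def C2A (L ρ : ℝ) : ℝ :=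
  4 * L ^ 4 * ((1 / 2 * (1 + 2 * Real.exp 2 / 3) + (6 + Real.exp 2) / 3) ^ 2
    + 36 * ρ ^ 2 * Real.exp 4)

def D2A (M ρ : ℝ) : ℝ :=
  4 * M ^ 2 * ((83 / 4 + 24 * Real.exp 4 / 5) ^ 2
    + ρ ^ 4 * (243 / 16 + 27 * Real.exp 4) ^ 2)

def V2A (L M σ : ℝ) : ℝ :=
  4 * M ^ 2 * σ ^ 4 * (243 / 16 + 27 * Real.exp 4) ^ 2 + 144 * Real.exp 4 * L ^ 4 * σ ^ 2

/-- `S = ∑_{k ≥ 0} η_k³ n³ L³`. -/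
def cubicSum (n : ℕ) (L η₀ : ℝ) : ℝ := ∑' k, stepsize η₀ k ^ 3 * (n : ℝ) ^ 3 * L ^ 3

/-- `e^S (Δ² + 6 S V_{1A}² / L⁶)`, where `Δ` is the initial distance to the zero. -/
def radiusSq (n : ℕ) (L M σ η₀ Δ : ℝ) : ℝ :=
  Real.exp (cubicSum n L η₀) * (Δ ^ 2 + 6 * cubicSum n L η₀ * V1A L M σ ^ 2 / L ^ 6)

/-- The first smallness condition on `η₀`. -/
def StepCond₁ (n : ℕ) (L M ρ σ η₀ Δ : ℝ) : Prop :=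
  η₀ ^ 2 * (n : ℝ) ^ 2 * L ^ 2 + 3 * η₀ * n * C1A L ρ ^ 2 / L ^ 3
    + 3 * η₀ * n * D1A M ρ ^ 2 / L * radiusSq n L M σ η₀ Δ ≤ 1

/-- The second smallness condition on `η₀`, with parameter `lam`. -/
def StepCond₂ (n : ℕ) (L M ρ σ η₀ Δ lam : ℝ) : Prop :=
  η₀ ^ 2 * (n : ℝ) ^ 2 * L ^ 2 + η₀ * n * C2A L ρ / L ^ 3
    + η₀ * n * D2A M ρ / L * radiusSq n L M σ η₀ Δ ≤ 1 - lam

/-- The constant in front of `(log (K + 3))² / (K + 3)^(1/3)` in the convergence bound. -/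
def rateConst (n : ℕ) (L M σ η₀ Δ lam : ℝ) : ℝ :=
  (Δ ^ 2 + 3 * V2A L M σ / (n * L ^ 6)) /
    (lam * Real.exp (-(3 / 2)) * ((2 : ℝ) ^ (1 / 3 : ℝ) * Real.log 2) ^ 2 * η₀ ^ 2 * (n : ℝ) ^ 2)

/-- A random sequence `z` started at `z0` whose within-epoch errors
`r k = z (k + 1) - (z k - η_k n F (z k - η_k n F (z k)))` satisfy the almost sure bound
`‖r k‖ ≤ η_k³ n³ (C_{1A} ‖F (z k)‖ + D_{1A} ‖F (z k)‖² + V_{1A})` and the conditional bound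
`𝔼[‖r k‖² | z k] ≤ η_k⁶ n⁶ C_{2A} ‖F (z k)‖² + η_k⁶ n⁶ D_{2A} ‖F (z k)‖⁴ + η_k⁶ n⁵ V_{2A}`. -/
structure IsCubicErrorMethod {Ω E : Type*} [MeasurableSpace Ω] [NormedAddCommGroup E]
    [InnerProductSpace ℝ E] [MeasurableSpace E] (P : Measure Ω) {n : ℕ} (F : Fin n → E → E)
    (L M ρ σ : ℝ) (η : ℕ → ℝ) (z0 : E) (z : ℕ → Ω → E) : Prop where
  measurable : ∀ k, Measurable (z k)
  init : ∀ᵐ ω ∂P, z 0 ω = z0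
  error_le : ∀ k, ∀ᵐ ω ∂P,
    ‖epochError F (η k) (z k ω) (z (k + 1) ω)‖ ≤
      η k ^ 3 * (n : ℝ) ^ 3 * C1A L ρ * ‖fullOp F (z k ω)‖
      + η k ^ 3 * (n : ℝ) ^ 3 * D1A M ρ * ‖fullOp F (z k ω)‖ ^ 2
      + η k ^ 3 * (n : ℝ) ^ 3 * V1A L M σ
  condExp_error_le : ∀ k, ∀ᵐ ω ∂P,
    condExp (MeasurableSpace.comap (z k) inferInstance) P
      (fun ω' => ‖epochError F (η k) (z k ω') (z (k + 1) ω')‖ ^ 2) ω ≤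
      η k ^ 6 * (n : ℝ) ^ 6 * C2A L ρ * ‖fullOp F (z k ω)‖ ^ 2
      + η k ^ 6 * (n : ℝ) ^ 6 * D2A M ρ * ‖fullOp F (z k ω)‖ ^ 4
      + η k ^ 6 * (n : ℝ) ^ 5 * V2A L M σ

/-- The convergence guarantee for a random sequence `z`: the expectations are finite, the
explicit bound with constant `c` holds for each `K ≥ 1`, and so the minimal expected squared norm
is `O((log K)² / K^(1/3))`. -/
structure HasRate {Ω E : Type*} [MeasurableSpace Ω] [NormedAddCommGroup E] (P : Measure Ω)
    (G : E → E) (c : ℝ) (z : ℕ → Ω → E) : Prop where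
  integrable : ∀ k, Integrable (fun ω => ‖G (z k ω)‖ ^ 2) P
  bound : ∀ K : ℕ, 1 ≤ K → minExpectedSqNorm P G z K ≤
    Real.log ((K : ℝ) + 3) ^ 2 / ((K : ℝ) + 3) ^ (1 / 3 : ℝ) * c
  isBigO : (fun K : ℕ => minExpectedSqNorm P G z K) =O[atTop]
    fun K : ℕ => Real.log (K : ℝ) ^ 2 / (K : ℝ) ^ (1 / 3 : ℝ)

end SEGFFA

end

noncomputable section

namespace SEGFFA

/-! Up to third order in the stepsize, an epoch is one extragradient step of length `h = η n` for
the averaged operator `F`. Because the extrapolation uses `η / 2`, the second-order term at position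
`i` is the derivative of the `i`-th operator applied to the midpoint of two consecutive partial sums
of operator values. In a palindromic order, mirrored positions carry the same derivative and their
midpoints add up to the full sum. The total is therefore half the summed derivative applied to the
summed values, whatever the permutation (`sum_fderiv_midSum_of_palindrome`). Anchoring halves the
run and leaves `z - h F z + h² DF(z) F z`, the expansion of the extragradient step
(`epochError_epoch_eq`).

The remainder is governed by the displacements within the epoch (`displacement_bounds`), hence by
the partial sums of `F_i z - F z`. These are at most `n (ρ‖F z‖ + σ)` in the worst case. In mean
square over the permutation they gain a factor `√n`, since samples drawn without replacement are
negatively correlated (`sum_perm_inner_nonpos`). This gives the almost sure cubic bound and the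
second-moment bound with `n⁵` in the noise term.

From there only the two error bounds matter. An exact extragradient step lowers `‖z - z*‖²` by `h²
(1 - h² L²) ‖F z‖²`. Young's inequality with weight `γ = h³ L³` charges an error `r` as `‖r‖² / γ`,
again of cubic order, plus a growth factor `1 + γ`. The logarithm in the stepsize makes `∑ γ`
converge. The recursion is run twice. Pathwise, the first smallness condition keeps the iterates in
a ball of squared radius `R` (`norm_sub_sq_le_radiusSq`), so that `‖F z‖⁴ ≤ L² R ‖F z‖²`. In
expectation, the second condition then leaves a decrease `λ h² 𝔼‖F z‖²` (`integral_norm_sub_sq_le`).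
Summing over epochs and bounding `∑ η_k²` from below (`cbrt_div_log_sq_le_sum`) gives the rate. -/

theorem norm_add_sq_le_of_pos {V : Type*} [SeminormedAddCommGroup V] (a b : V) {γ : ℝ} (hγ : 0 < γ) :
    ‖a + b‖ ^ 2 ≤ (1 + γ) * (‖a‖ ^ 2 + ‖b‖ ^ 2 / γ) := by
  have h1 : ‖a + b‖ ^ 2 ≤ (‖a‖ + ‖b‖) ^ 2 := pow_le_pow_left₀ (norm_nonneg _) (norm_add_le _ _) 2
  have h2 : (1 + γ) * (‖a‖ ^ 2 + ‖b‖ ^ 2 / γ) - (‖a‖ + ‖b‖) ^ 2 = (γ * ‖a‖ - ‖b‖) ^ 2 / γ := by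
    field_simp; ring
  have h3 : 0 ≤ (γ * ‖a‖ - ‖b‖) ^ 2 / γ := by positivity
  linarith

/-! ### Smooth operators and the deterministic extragradient step. -/

section Smooth

variable {E : Type*} [NormedAddCommGroup E] [InnerProductSpace ℝ E]

/-- Mean value inequality on the closed ball of radius `‖w - z‖`, where the derivative varies by at
most `M ‖w - z‖`. The missing factor `1/2` is absorbed by the generous final constants. -/
theorem IsSmoothOp.taylor {L M : ℝ} {G : E → E} (hG : IsSmoothOp L M G) (hM : 0 ≤ M) (z w : E) :
    ‖G w - G z - fderiv ℝ G z (w - z)‖ ≤ M * ‖w - z‖ ^ 2 := by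
  have h := (convex_closedBall z ‖w - z‖).norm_image_sub_le_of_norm_fderiv_le' (𝕜 := ℝ) (f := G)
    (φ := fderiv ℝ G z) (C := M * ‖w - z‖) (x := z) (y := w)
    (fun x _ => hG.differentiable x)
    (fun x hx => (hG.lipschitz_fderiv x z).trans
      (mul_le_mul_of_nonneg_left (by simpa [dist_eq_norm] using hx) hM))
    (by simp) (by simp [dist_eq_norm])
  calc _ ≤ _ := h
    _ = _ := by ring

theorem IsSmoothOp.norm_fderiv_le {L M : ℝ} {G : E → E} (hG : IsSmoothOp L M G) (hL : 0 ≤ L)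
    (z : E) : ‖fderiv ℝ G z‖ ≤ L :=
  norm_fderiv_le_of_lipschitz ℝ (C := ⟨L, hL⟩)
    (LipschitzWith.of_dist_le_mul fun x y => by
      rw [dist_eq_norm, dist_eq_norm]; exact hG.lipschitz x y)

theorem IsSmoothOp.continuous {L M : ℝ} {G : E → E} (hG : IsSmoothOp L M G) : Continuous G :=
  hG.differentiable.continuous

theorem fderiv_fullOp {n : ℕ} {F : Fin n → E → E} (hF : ∀ i, Differentiable ℝ (F i)) (z : E) :
    fderiv ℝ (fullOp F) z = (n : ℝ)⁻¹ • ∑ i, fderiv ℝ (F i) z := by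
  have h1 : HasFDerivAt (fun z => ∑ i, F i z) (∑ i, fderiv ℝ (F i) z) z :=
    HasFDerivAt.fun_sum fun i _ => (hF i z).hasFDerivAt
  exact (h1.const_smul _).fderiv

theorem norm_inv_smul_sum_le {V : Type*} [NormedAddCommGroup V] [NormedSpace ℝ V] {n : ℕ}
    [NeZero n] (v : Fin n → V) (c : ℝ) (h : ∀ i, ‖v i‖ ≤ c) : ‖(n : ℝ)⁻¹ • ∑ i, v i‖ ≤ c := by
  have hn : (0 : ℝ) < n := by exact_mod_cast Nat.pos_of_ne_zero (NeZero.ne n)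
  rw [norm_smul, norm_inv, Real.norm_natCast, inv_mul_le_iff₀ hn]
  calc ‖∑ i, v i‖ ≤ ∑ _i : Fin n, c := norm_sum_le_of_le _ fun i _ => h i
    _ = n * c := by simp

theorem isSmoothOp_fullOp {n : ℕ} [NeZero n] {L M : ℝ} {F : Fin n → E → E}
    (hF : ∀ i, IsSmoothOp L M (F i)) : IsSmoothOp L M (fullOp F) where
  lipschitz z w := by
    rw [fullOp, fullOp, ← smul_sub, ← Finset.sum_sub_distrib]
    exact norm_inv_smul_sum_le _ _ fun i => (hF i).lipschitz z w
  differentiable z :=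
    (DifferentiableAt.fun_sum fun i _ => (hF i).differentiable z).const_smul _
  lipschitz_fderiv z w := by
    rw [fderiv_fullOp fun i => (hF i).differentiable, fderiv_fullOp fun i => (hF i).differentiable,
      ← smul_sub, ← Finset.sum_sub_distrib]
    exact norm_inv_smul_sum_le _ _ fun i => (hF i).lipschitz_fderiv z w

/-- The descent inequality of a deterministic extragradient step. -/
theorem extragradient_descent {G : E → E} {L h : ℝ} {zs : E} (hh : 0 ≤ h)
    (hG : ∀ z w, ‖G z - G w‖ ≤ L * ‖z - w‖) (hstar : IsStarMonotone G zs) (z : E) :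
    ‖z - h • G (z - h • G z) - zs‖ ^ 2 ≤
      ‖z - zs‖ ^ 2 - h ^ 2 * (1 - h ^ 2 * L ^ 2) * ‖G z‖ ^ 2 := by
  set w := z - h • G z with hw
  -- Star-monotonicity is tested at the extrapolated point `w`, not at `z`.
  have h1 : 0 ≤ inner ℝ (G w) (z - zs) - h * inner ℝ (G w) (G z) := by
    have h2 := hstar w
    have h3 : w - zs = (z - zs) - h • G z := by rw [hw]; abel
    rwa [h3, inner_sub_right, inner_smul_right] at h2
  have h4 : ‖z - h • G w - zs‖ ^ 2 =
      ‖z - zs‖ ^ 2 - 2 * h * inner ℝ (G w) (z - zs) + h ^ 2 * ‖G w‖ ^ 2 := by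
    have h5 : z - h • G w - zs = (z - zs) - h • G w := by abel
    rw [h5, norm_sub_sq_real, inner_smul_right, norm_smul, real_inner_comm, mul_pow,
      Real.norm_eq_abs, sq_abs]
    ring
  have h6 : ‖G w - G z‖ ^ 2 = ‖G w‖ ^ 2 - 2 * inner ℝ (G w) (G z) + ‖G z‖ ^ 2 :=
    norm_sub_sq_real _ _
  have h7 : ‖G w - G z‖ ^ 2 ≤ L ^ 2 * h ^ 2 * ‖G z‖ ^ 2 := by
    have h8 : ‖w - z‖ = h * ‖G z‖ := by
      rw [hw, sub_sub_cancel_left, norm_neg, norm_smul, Real.norm_of_nonneg hh]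
    have h9 := hG w z
    rw [h8] at h9
    calc _ ≤ (L * (h * ‖G z‖)) ^ 2 := pow_le_pow_left₀ (norm_nonneg _) h9 2
      _ = _ := by ring
  rw [h4]
  -- The cross term `-2 h² ⟪G w, G z⟫` combines with `h² ‖G w‖²` into `h² (‖G w - G z‖² - ‖G z‖²)`.
  nlinarith [mul_nonneg hh h1, mul_le_mul_of_nonneg_left h7 (sq_nonneg h)]

end Smooth

theorem sum_range_sub_of_palindrome {V : Type*} [AddCommGroup V] {N : ℕ} {v : ℕ → V}
    (hpal : ∀ i < N, v (N - 1 - i) = v i) {i : ℕ} (hi : i ≤ N) :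
    ∑ l ∈ Finset.range (N - i), v l = ∑ l ∈ Finset.range N, v l - ∑ l ∈ Finset.range i, v l := by
  induction i with
  | zero => simp
  | succ i ih =>
    have e1 : N - i = N - (i + 1) + 1 := by omega
    have e2 := ih (by omega)
    have e3 : v (N - (i + 1)) = v i := by
      rw [← hpal i (by omega)]; congr 1; omega
    rw [e1, Finset.sum_range_succ, e3] at e2
    rw [Finset.sum_range_succ, ← sub_sub, ← e2]; abel

/-! ### Second-order expansion of a run of same-sample steps. -/

section Expansion

variable {E : Type*} [NormedAddCommGroup E] [InnerProductSpace ℝ E]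
  {L M η : ℝ} {G : ℕ → E → E} {z : ℕ → E}

/-- The extrapolated point of a same-sample step with stepsizes `η / 2` and `η`. -/
def halfStep (η : ℝ) (G : ℕ → E → E) (z : ℕ → E) (i : ℕ) : E := z i - (η / 2) • G i (z i)

theorem segStep_iterate_eq (hz : ∀ i, z (i + 1) = segStep (η / 2) η (G i) (z i)) (N : ℕ) :
    z N = z 0 - η • ∑ i ∈ Finset.range N, G i (halfStep η G z i) := by
  induction N with
  | zero => simp
  | succ N ih =>
    rw [Finset.sum_range_succ, hz N, segStep]
    change z N - η • G N (halfStep η G z N) = _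
    rw [ih, smul_add]; abel

theorem norm_iterate_sub_le (hη : 0 ≤ η) (hG : ∀ i, IsSmoothOp L M (G i))
    (hz : ∀ i, z (i + 1) = segStep (η / 2) η (G i) (z i)) (N : ℕ) :
    ‖z N - z 0‖ ≤ η * ‖∑ i ∈ Finset.range N, G i (z 0)‖ +
      η * L * ∑ i ∈ Finset.range N, ‖halfStep η G z i - z 0‖ := by
  have h1 : z N - z 0 = -(η • (∑ i ∈ Finset.range N, G i (z 0) +
      ∑ i ∈ Finset.range N, (G i (halfStep η G z i) - G i (z 0)))) := by
    rw [segStep_iterate_eq hz N, Finset.sum_sub_distrib]; module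
  have h2 : ‖∑ i ∈ Finset.range N, (G i (halfStep η G z i) - G i (z 0))‖ ≤
      L * ∑ i ∈ Finset.range N, ‖halfStep η G z i - z 0‖ := by
    rw [Finset.mul_sum]
    exact norm_sum_le_of_le _ fun i _ => (hG i).lipschitz _ _
  rw [h1, norm_neg, norm_smul, Real.norm_of_nonneg hη, mul_assoc, ← mul_add]
  exact mul_le_mul_of_nonneg_left ((norm_add_le _ _).trans (by gcongr)) hη

/-- The midpoint of two consecutive partial sums of the operator values at `z₀`. -/
def midSum (G : ℕ → E → E) (z₀ : E) (i : ℕ) : E :=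
  (1 / 2 : ℝ) • (∑ l ∈ Finset.range i, G l z₀ + ∑ l ∈ Finset.range (i + 1), G l z₀)

/-- The first-order error of a half step. -/
def halfStepError (η : ℝ) (G : ℕ → E → E) (z : ℕ → E) (i : ℕ) : E :=
  ∑ l ∈ Finset.range i, (G l (halfStep η G z l) - G l (z 0)) + (1 / 2 : ℝ) • (G i (z i) - G i (z 0))

/-- The extrapolation adds half of the current operator value to the sum of the earlier ones. This
is where the ratio `α = β / 2` produces midpoints, the form that is symmetric under reversal. -/
theorem halfStep_sub_eq (hz : ∀ i, z (i + 1) = segStep (η / 2) η (G i) (z i)) (i : ℕ) :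
    halfStep η G z i - z 0 = -(η • (midSum G (z 0) i + halfStepError η G z i)) := by
  have h := segStep_iterate_eq hz i
  have h2 : halfStep η G z i - z 0 = (z i - z 0) - (η / 2) • G i (z i) := by
    rw [halfStep]; abel
  have h3 : z i - z 0 = - (η • ∑ l ∈ Finset.range i, G l (halfStep η G z l)) := by
    conv_lhs => rw [h]
    abel
  rw [h2, h3, midSum, halfStepError, Finset.sum_sub_distrib, Finset.sum_range_succ]
  module

theorem norm_halfStepError_le (hG : ∀ i, IsSmoothOp L M (G i)) (i : ℕ) :
    ‖halfStepError η G z i‖ ≤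
      L * (∑ l ∈ Finset.range i, ‖halfStep η G z l - z 0‖ + 1 / 2 * ‖z i - z 0‖) := by
  rw [mul_add, Finset.mul_sum]
  refine (norm_add_le _ _).trans (add_le_add
    (norm_sum_le_of_le _ fun l _ => (hG l).lipschitz _ _) ?_)
  rw [norm_smul, Real.norm_of_nonneg (by norm_num)]
  linarith [(hG i).lipschitz (z i) (z 0)]

theorem norm_halfStep_sub_le (hη : 0 ≤ η) (hG : ∀ i, IsSmoothOp L M (G i))
    (hz : ∀ i, z (i + 1) = segStep (η / 2) η (G i) (z i)) (i : ℕ) :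
    ‖halfStep η G z i - z 0‖ ≤ η * ‖midSum G (z 0) i‖ +
      η * L * (∑ l ∈ Finset.range i, ‖halfStep η G z l - z 0‖ + 1 / 2 * ‖z i - z 0‖) := by
  rw [halfStep_sub_eq hz, norm_neg, norm_smul, Real.norm_of_nonneg hη, mul_assoc, ← mul_add]
  exact mul_le_mul_of_nonneg_left ((norm_add_le _ _).trans
    (add_le_add le_rfl (norm_halfStepError_le hG i))) hη

/-- Second-order expansion of a run of same-sample extragradient steps. -/
theorem norm_iterate_sub_expansion_le (hη : 0 ≤ η) (hL : 0 ≤ L) (hM : 0 ≤ M)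
    (hG : ∀ i, IsSmoothOp L M (G i))
    (hz : ∀ i, z (i + 1) = segStep (η / 2) η (G i) (z i)) (N : ℕ) :
    ‖z N - (z 0 - η • ∑ i ∈ Finset.range N, G i (z 0) +
        η ^ 2 • ∑ i ∈ Finset.range N, fderiv ℝ (G i) (z 0) (midSum G (z 0) i))‖ ≤
      η ^ 2 * L ^ 2 * ∑ i ∈ Finset.range N,
        (∑ l ∈ Finset.range i, ‖halfStep η G z l - z 0‖ + 1 / 2 * ‖z i - z 0‖) +
      η * M * ∑ i ∈ Finset.range N, ‖halfStep η G z i - z 0‖ ^ 2 := by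
  set rem : ℕ → E := fun i => G i (halfStep η G z i) - G i (z 0) -
    fderiv ℝ (G i) (z 0) (halfStep η G z i - z 0) with hrem
  -- Linearisation at `z 0` along the displacement from `halfStep_sub_eq`: the midpoint gives the
  -- second-order term, `halfStepError` and `rem` give the third-order remainder.
  have h1 : ∀ i, G i (halfStep η G z i) = G i (z 0) -
      η • fderiv ℝ (G i) (z 0) (midSum G (z 0) i) -
      η • fderiv ℝ (G i) (z 0) (halfStepError η G z i) + rem i := by
    intro i
    simp only [hrem]
    rw [halfStep_sub_eq hz i, map_neg, map_smul, map_add, smul_add]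
    abel
  have h2 : z N - (z 0 - η • ∑ i ∈ Finset.range N, G i (z 0) +
        η ^ 2 • ∑ i ∈ Finset.range N, fderiv ℝ (G i) (z 0) (midSum G (z 0) i)) =
      η ^ 2 • ∑ i ∈ Finset.range N, fderiv ℝ (G i) (z 0) (halfStepError η G z i) -
        η • ∑ i ∈ Finset.range N, rem i := by
    conv_lhs => rw [segStep_iterate_eq hz N]
    rw [Finset.sum_congr rfl fun i _ => h1 i]
    simp only [Finset.sum_add_distrib, Finset.sum_sub_distrib, ← Finset.smul_sum]
    module
  rw [h2]
  refine (norm_sub_le _ _).trans (add_le_add ?_ ?_)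
  · rw [norm_smul, Real.norm_of_nonneg (sq_nonneg η), mul_assoc]
    refine mul_le_mul_of_nonneg_left ?_ (sq_nonneg η)
    rw [Finset.mul_sum]
    refine norm_sum_le_of_le _ fun i _ => ?_
    calc _ ≤ L * ‖halfStepError η G z i‖ :=
          (ContinuousLinearMap.le_of_opNorm_le _ ((hG i).norm_fderiv_le hL _) _)
      _ ≤ L * (L * _) := mul_le_mul_of_nonneg_left (norm_halfStepError_le hG i) hL
      _ = _ := by ring
  · rw [norm_smul, Real.norm_of_nonneg hη, mul_assoc]
    refine mul_le_mul_of_nonneg_left ?_ hη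
    rw [Finset.mul_sum]
    exact norm_sum_le_of_le _ fun i _ => (hG i).taylor hM _ _

/-- The second-order term of a palindromic run is that of one step with the sum of the
operators. -/
theorem sum_fderiv_midSum_of_palindrome {N : ℕ} (hpal : ∀ i < N, G (N - 1 - i) = G i) (z₀ : E) :
    ∑ i ∈ Finset.range N, fderiv ℝ (G i) z₀ (midSum G z₀ i) =
      (1 / 2 : ℝ) • (∑ i ∈ Finset.range N, fderiv ℝ (G i) z₀) (∑ i ∈ Finset.range N, G i z₀) := by
  set S : ℕ → E := fun i => ∑ l ∈ Finset.range i, G l z₀ with hS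
  have hsym : ∀ i ≤ N, S (N - i) = S N - S i := fun i hi =>
    sum_range_sub_of_palindrome (v := fun l => G l z₀) (fun l hl => by rw [hpal l hl]) hi
  -- The midpoint at the mirrored position is `S N` minus the midpoint at `i`. Reflecting the sum
  -- `X` then yields `(∑ DG_i)(S N) - X = X`.
  have h1 : ∀ i ∈ Finset.range N, fderiv ℝ (G (N - 1 - i)) z₀ (midSum G z₀ (N - 1 - i)) =
      fderiv ℝ (G i) z₀ (S N) - fderiv ℝ (G i) z₀ (midSum G z₀ i) := by
    intro i hi
    have hi' := Finset.mem_range.1 hi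
    rw [hpal i hi', ← map_sub]
    congr 1
    have e1 : N - 1 - i = N - (i + 1) := by omega
    have e2 : N - 1 - i + 1 = N - i := by omega
    have e3 : midSum G z₀ (N - 1 - i) = (1 / 2 : ℝ) • (S (N - 1 - i) + S (N - 1 - i + 1)) := rfl
    have e4 : midSum G z₀ i = (1 / 2 : ℝ) • (S i + S (i + 1)) := rfl
    rw [e3, e4, e2, e1, hsym _ (by omega), hsym _ (by omega)]
    module
  have h2 := Finset.sum_range_reflect (fun i => fderiv ℝ (G i) z₀ (midSum G z₀ i)) N
  rw [Finset.sum_congr rfl h1, Finset.sum_sub_distrib, sub_eq_iff_eq_add, ← two_smul ℝ] at h2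
  rw [sum_apply]
  change _ = (1 / 2 : ℝ) • ∑ i ∈ Finset.range N, fderiv ℝ (G i) z₀ (S N)
  rw [h2, smul_smul]
  norm_num

end Expansion

/-- A discrete Grönwall estimate for the displacements within an epoch. -/
theorem displacement_bounds {η L φ : ℝ} {n : ℕ} [NeZero n] (hη : 0 ≤ η) (hL : 0 ≤ L) (hφ : 0 ≤ φ)
    (hx : η * n * L ≤ 1 / 100) {p q T : ℕ → ℝ} (hp : ∀ i, 0 ≤ p i) (hq : ∀ i, 0 ≤ q i)
    (hT : ∀ i, 0 ≤ T i) (hT0 : T (2 * n) = T 0)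
    (hqle : ∀ i, i < 2 * n → q i ≤ η * (2 * n * φ + T i) + η * L * ∑ l ∈ Finset.range i, p l)
    (hple : ∀ i, i < 2 * n → p i ≤ η * (2 * n * φ + (T i + T (i + 1)) / 2) +
      η * L * (∑ l ∈ Finset.range i, p l + 1 / 2 * q i)) :
    η ^ 2 * L ^ 2 * ∑ i ∈ Finset.range (2 * n), (∑ l ∈ Finset.range i, p l + 1 / 2 * q i) ≤
        η ^ 3 * (L ^ 2 * (12 * n ^ 3 * φ + 4 * n * ∑ i ∈ Finset.range (2 * n), T i)) ∧
      ∑ i ∈ Finset.range (2 * n), p i ^ 2 ≤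
        η ^ 2 * (54 * n ^ 3 * φ ^ 2 + 15 * ∑ i ∈ Finset.range (2 * n), T i ^ 2) := by
  have hn : (1 : ℝ) ≤ n := by exact_mod_cast Nat.one_le_iff_ne_zero.2 (NeZero.ne n)
  set P := ∑ i ∈ Finset.range (2 * n), p i with hP
  set Q := ∑ i ∈ Finset.range (2 * n), q i with hQ
  set A := ∑ i ∈ Finset.range (2 * n), T i with hA
  set B := ∑ i ∈ Finset.range (2 * n), T i ^ 2 with hB
  have hP0 : 0 ≤ P := Finset.sum_nonneg fun i _ => hp i
  have hQ0 : 0 ≤ Q := Finset.sum_nonneg fun i _ => hq i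
  have hA0 : 0 ≤ A := Finset.sum_nonneg fun i _ => hT i
  have hB0 : 0 ≤ B := Finset.sum_nonneg fun i _ => sq_nonneg _
  have hηL : 0 ≤ η * L := mul_nonneg hη hL
  -- The two sums differ by the end terms `T 0` and `T (2 * n)`, which agree.
  have hshift : ∑ i ∈ Finset.range (2 * n), T (i + 1) = A := by
    have h1 := Finset.sum_range_succ T (2 * n)
    rw [Finset.sum_range_succ', hT0] at h1
    linarith
  have hshift2 : ∑ i ∈ Finset.range (2 * n), T (i + 1) ^ 2 = B := by
    have h1 := Finset.sum_range_succ (fun i => T i ^ 2) (2 * n)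
    rw [Finset.sum_range_succ', hT0] at h1
    linarith
  have hpart : ∀ i, i < 2 * n → ∑ l ∈ Finset.range i, p l ≤ P := fun i hi =>
    Finset.sum_le_sum_of_subset_of_nonneg (Finset.range_mono hi.le) fun l _ _ => hp l
  have hqQ : ∀ i, i < 2 * n → q i ≤ Q := fun i hi =>
    Finset.single_le_sum (fun l _ => hq l) (Finset.mem_range.2 hi)
  -- `Y` is the sum of the first-order bounds. Both `P` and `Q` are at most `Y` plus small multiples
  -- of `P` and `Q`, and `η n L ≤ 1/100` lets these be absorbed into the factor `11/10`.
  set Y := η * (4 * n ^ 2 * φ + A) with hY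
  have hY0 : 0 ≤ Y := by positivity
  have hdouble : ∑ i ∈ Finset.range (2 * n), (∑ l ∈ Finset.range i, p l + 1 / 2 * q i) ≤
      2 * n * P + 1 / 2 * Q := by
    rw [Finset.sum_add_distrib, ← Finset.mul_sum]
    gcongr
    calc _ ≤ ∑ _i ∈ Finset.range (2 * n), P :=
          Finset.sum_le_sum fun i hi => hpart i (Finset.mem_range.1 hi)
      _ = 2 * n * P := by simp
  have hQle : Q ≤ Y + 2 * (η * n * L) * P := by
    calc Q ≤ ∑ i ∈ Finset.range (2 * n), (η * (2 * n * φ + T i) + η * L * P) :=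
          Finset.sum_le_sum fun i hi => (hqle i (Finset.mem_range.1 hi)).trans (by
            gcongr; exact hpart i (Finset.mem_range.1 hi))
      _ = Y + 2 * (η * n * L) * P := by
          rw [Finset.sum_add_distrib, ← Finset.mul_sum, Finset.sum_add_distrib, ← hA]
          simp only [Finset.sum_const, Finset.card_range, nsmul_eq_mul]
          push_cast; ring
  have hPle : P ≤ Y + η * L * (2 * n * P + 1 / 2 * Q) := by
    calc P ≤ ∑ i ∈ Finset.range (2 * n), (η * (2 * n * φ + (T i + T (i + 1)) / 2) +
          η * L * (∑ l ∈ Finset.range i, p l + 1 / 2 * q i)) :=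
          Finset.sum_le_sum fun i hi => hple i (Finset.mem_range.1 hi)
      _ = Y + η * L * ∑ i ∈ Finset.range (2 * n), (∑ l ∈ Finset.range i, p l + 1 / 2 * q i) := by
          rw [Finset.sum_add_distrib, ← Finset.mul_sum, ← Finset.mul_sum, Finset.sum_add_distrib,
            ← Finset.sum_div, Finset.sum_add_distrib, hshift, ← hA, Finset.sum_const,
            Finset.card_range, nsmul_eq_mul, hY]
          push_cast; ring
      _ ≤ _ := by gcongr
  have hηLx : η * L ≤ 1 / 100 := by
    refine le_trans ?_ hx
    nlinarith
  have hxP : (η * n * L) * P ≤ 1 / 100 * P := by gcongr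
  have hxQ : (η * L) * Q ≤ 1 / 100 * Q := by gcongr
  have hP1 : P ≤ 11 / 10 * Y := by linarith
  have hQ1 : Q ≤ 11 / 10 * Y := by linarith
  constructor
  · calc _ ≤ η ^ 2 * L ^ 2 * (2 * n * (11 / 10 * Y) + 1 / 2 * (11 / 10 * Y)) := by
          refine mul_le_mul_of_nonneg_left (hdouble.trans ?_) (by positivity)
          gcongr
      _ ≤ η ^ 2 * L ^ 2 * (3 * n * Y) := by
          refine mul_le_mul_of_nonneg_left ?_ (by positivity)
          nlinarith
      _ ≤ _ := by
          have : 0 ≤ η ^ 3 * L ^ 2 * (n * A) := by positivity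
          rw [hY]
          nlinarith
  -- The feedback from all other displacements enters only through the average `A / n`; the local
  -- values `T i` stay separate so that squaring leaves `∑ T i ^ 2`, which can later be averaged
  -- over permutations.
  · have hpi : ∀ i, i < 2 * n → p i ≤ η * (3 * n * φ + (T i + T (i + 1)) / 2 + A / n) := by
      intro i hi
      have h1 : η * L * (∑ l ∈ Finset.range i, p l + 1 / 2 * q i) ≤ η * L * (2 * Y) := by
        gcongr
        linarith [hpart i hi, hqQ i hi]
      have h2 : η * L * (2 * Y) ≤ η * (n * φ + A / n) := by
        have : η * L * (2 * Y) = (η * n * L) * (η * (8 * n * φ + 2 * (A / n))) := by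
          rw [hY]; field_simp; ring
        rw [this]
        have h3 : 0 ≤ η * (n * φ) := by positivity
        have h4 : 0 ≤ η * (A / n) := by positivity
        calc _ ≤ 1 / 100 * (η * (8 * n * φ + 2 * (A / n))) := by gcongr
          _ ≤ _ := by nlinarith
      calc p i ≤ _ := hple i hi
        _ ≤ η * (2 * n * φ + (T i + T (i + 1)) / 2) + η * (n * φ + A / n) := by linarith
        _ = _ := by ring
    have hcs : A ^ 2 ≤ 2 * n * B := by
      have := sq_sum_le_card_mul_sum_sq (s := Finset.range (2 * n)) (f := T)
      rw [Finset.card_range] at this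
      exact_mod_cast this
    have hcs2 : (A / n) ^ 2 ≤ 2 / n * B := by
      rw [div_pow, div_le_iff₀ (by positivity)]
      calc _ ≤ _ := hcs
        _ = _ := by field_simp
    have hsq : ∀ a b c : ℝ, (a + b + c) ^ 2 ≤ 3 * (a ^ 2 + b ^ 2 + c ^ 2) := fun a b c => by
      linarith [sq_nonneg (a - b), sq_nonneg (a - c), sq_nonneg (b - c)]
    -- After summation `54 = 3 · 9 · 2` and `15 = 3 · (1 + 4)`, the `4` coming from Cauchy–Schwarz
    -- for `A / n`.
    calc _ ≤ ∑ i ∈ Finset.range (2 * n), 3 * η ^ 2 *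
          (9 * n ^ 2 * φ ^ 2 + (T i ^ 2 + T (i + 1) ^ 2) / 2 + 2 / n * B) := by
          refine Finset.sum_le_sum fun i hi => ?_
          calc p i ^ 2 ≤ (η * (3 * n * φ + (T i + T (i + 1)) / 2 + A / n)) ^ 2 :=
                pow_le_pow_left₀ (hp i) (hpi i (Finset.mem_range.1 hi)) 2
            _ = η ^ 2 * (3 * n * φ + (T i + T (i + 1)) / 2 + A / n) ^ 2 := by ring
            _ ≤ η ^ 2 * (3 * (9 * n ^ 2 * φ ^ 2 + (T i ^ 2 + T (i + 1) ^ 2) / 2 + 2 / n * B)) := by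
                refine mul_le_mul_of_nonneg_left ?_ (sq_nonneg η)
                linarith [hsq (3 * n * φ) ((T i + T (i + 1)) / 2) (A / n),
                  sq_nonneg (T i - T (i + 1))]
            _ = _ := by ring
      _ = η ^ 2 * (54 * n ^ 3 * φ ^ 2 + 15 * B) := by
          rw [← Finset.mul_sum, Finset.sum_add_distrib, Finset.sum_add_distrib, ← Finset.sum_div,
            Finset.sum_add_distrib, hshift2, ← hB]
          simp only [Finset.sum_const, Finset.card_range, nsmul_eq_mul]
          push_cast; field_simp; ring

/-! ### Second moments under a uniform permutation. -/

section Permutations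

open Finset

variable {n : ℕ}

/-- Composing with a swap shows that the sum does not depend on the position `m`; summed over all
positions, each permutation contributes the full sum. -/
theorem card_mul_sum_perm_norm_sq {V : Type*} [Norm V] (y : Fin n → V) (m : Fin n) :
    n * ∑ π : Equiv.Perm (Fin n), ‖y (π m)‖ ^ 2 = (n.factorial : ℝ) * ∑ j, ‖y j‖ ^ 2 := by
  have h1 : ∀ m' : Fin n, ∑ π : Equiv.Perm (Fin n), ‖y (π m')‖ ^ 2 =
      ∑ π : Equiv.Perm (Fin n), ‖y (π m)‖ ^ 2 := fun m' => by
    rw [← Equiv.sum_comp (Equiv.mulRight (Equiv.swap m m'))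
      (fun π : Equiv.Perm (Fin n) => ‖y (π m)‖ ^ 2)]
    simp
  have h2 : ∑ m' : Fin n, ∑ π : Equiv.Perm (Fin n), ‖y (π m')‖ ^ 2 =
      (n.factorial : ℝ) * ∑ j, ‖y j‖ ^ 2 := by
    rw [sum_comm]
    simp_rw [fun π : Equiv.Perm (Fin n) => Equiv.sum_comp π (fun j => ‖y j‖ ^ 2)]
    simp [Fintype.card_perm]
  rw [← h2, sum_congr rfl fun m' _ => h1 m']
  simp

variable {V : Type*} [NormedAddCommGroup V] [InnerProductSpace ℝ V]

/-- By exchangeability all correlations of position `m` with another position are equal. Together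
with the variance at `m` they sum to zero, because the vectors do, so their common value cannot be
positive. -/
theorem sum_perm_inner_nonpos {y : Fin n → V} (hy : ∑ j, y j = 0) {m l : Fin n} (hml : l ≠ m) :
    ∑ π : Equiv.Perm (Fin n), inner ℝ (y (π m)) (y (π l)) ≤ 0 := by
  set c := ∑ π : Equiv.Perm (Fin n), inner ℝ (y (π m)) (y (π l)) with hc
  have h1 : ∀ l' ∈ univ.erase m, ∑ π : Equiv.Perm (Fin n), inner ℝ (y (π m)) (y (π l')) = c := by
    intro l' hl'
    have hl' := ne_of_mem_erase hl'
    rw [hc, ← Equiv.sum_comp (Equiv.mulRight (Equiv.swap l l'))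
      (fun π : Equiv.Perm (Fin n) => inner ℝ (y (π m)) (y (π l)))]
    simp [Equiv.swap_apply_of_ne_of_ne hml.symm hl'.symm]
  have h2 : ∑ l' : Fin n, ∑ π : Equiv.Perm (Fin n), inner ℝ (y (π m)) (y (π l')) = 0 := by
    rw [sum_comm]
    refine sum_eq_zero fun π _ => ?_
    rw [← inner_sum, Equiv.sum_comp π y, hy, inner_zero_right]
  rw [← sum_erase_add _ _ (mem_univ m), sum_congr rfl h1, sum_const, nsmul_eq_mul] at h2
  have h3 : 0 ≤ ∑ π : Equiv.Perm (Fin n), inner ℝ (y (π m)) (y (π m)) :=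
    sum_nonneg fun π _ => real_inner_self_nonneg
  have h4 : (0 : ℝ) < (#(univ.erase m) : ℝ) := by
    exact_mod_cast card_pos.2 ⟨l, mem_erase.2 ⟨hml, mem_univ l⟩⟩
  by_contra! h5
  linarith [mul_pos h4 h5]

/-- Sampling without replacement: the second moment of a partial sum of centred vectors is at
most that of sampling with replacement. -/
theorem card_mul_sum_perm_norm_sum_sq_le {y : Fin n → V} (hy : ∑ j, y j = 0) (A : Finset (Fin n)) :
    n * ∑ π : Equiv.Perm (Fin n), ‖∑ m ∈ A, y (π m)‖ ^ 2 ≤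
      #A * ((n.factorial : ℝ) * ∑ j, ‖y j‖ ^ 2) := by
  have h1 : ∑ π : Equiv.Perm (Fin n), ‖∑ m ∈ A, y (π m)‖ ^ 2 =
      ∑ m ∈ A, ∑ l ∈ A, ∑ π : Equiv.Perm (Fin n), inner ℝ (y (π m)) (y (π l)) := by
    simp_rw [← real_inner_self_eq_norm_sq, sum_inner, inner_sum]
    rw [sum_comm]
    exact sum_congr rfl fun m _ => sum_comm
  have h2 : ∀ m ∈ A, ∑ l ∈ A, ∑ π : Equiv.Perm (Fin n), inner ℝ (y (π m)) (y (π l)) ≤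
      ∑ π : Equiv.Perm (Fin n), ‖y (π m)‖ ^ 2 := by
    intro m hm
    rw [← sum_erase_add _ _ hm]
    simp_rw [real_inner_self_eq_norm_sq]
    have := sum_nonpos fun l (hl : l ∈ A.erase m) => sum_perm_inner_nonpos hy (ne_of_mem_erase hl)
    linarith
  calc _ ≤ n * ∑ m ∈ A, ∑ π : Equiv.Perm (Fin n), ‖y (π m)‖ ^ 2 := by
        rw [h1]; exact mul_le_mul_of_nonneg_left (sum_le_sum h2) (Nat.cast_nonneg n)
    _ = _ := by
        rw [mul_sum, sum_congr rfl fun m _ => card_mul_sum_perm_norm_sq y m]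
        simp

end Permutations

/-! ### Flip-flop order and the deviations of its partial sums. -/

section FlipFlop

variable {E : Type*} {n : ℕ} [NeZero n]

theorem flipFlopOp_of_lt (F : Fin n → E → E) (π : Equiv.Perm (Fin n)) (i : Fin n) :
    flipFlopOp F π i = F (π i) := by
  rw [flipFlopOp, if_pos i.2]; congr 2; exact Fin.ofNat_val_eq_self i

theorem flipFlopOp_reflect (F : Fin n → E → E) (π : Equiv.Perm (Fin n)) {i : ℕ} (hi : i < 2 * n) :
    flipFlopOp F π (2 * n - 1 - i) = flipFlopOp F π i := by
  unfold flipFlopOp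
  split_ifs <;> first | omega | rfl | skip
  congr 4; omega

theorem sum_flipFlopOp {V : Type*} [AddCommGroup V] (F : Fin n → E → E) (π : Equiv.Perm (Fin n))
    (v : (E → E) → V) :
    ∑ i ∈ Finset.range (2 * n), v (flipFlopOp F π i) = ∑ j, v (F j) + ∑ j, v (F j) := by
  have h1 : ∑ i ∈ Finset.range n, v (flipFlopOp F π i) = ∑ j, v (F j) := by
    rw [Finset.sum_range, ← Equiv.sum_comp π fun j => v (F j)]
    exact Finset.sum_congr rfl fun j _ => by rw [flipFlopOp_of_lt]
  have h2 := sum_range_sub_of_palindrome (N := 2 * n) (v := fun i => v (flipFlopOp F π i))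
    (fun i hi => by rw [flipFlopOp_reflect F π hi]) (i := n) (by omega)
  rw [show 2 * n - n = n by omega, h1] at h2
  exact (sub_eq_iff_eq_add.1 h2.symm)

end FlipFlop

section Deviation

variable {E : Type*} [NormedAddCommGroup E] [InnerProductSpace ℝ E] {n : ℕ} [NeZero n]

/-- The norm of the sum of the first `i` deviations of the sampled components from the full
operator. -/
def devNorm (F : Fin n → E → E) (π : Equiv.Perm (Fin n)) (z : E) (i : ℕ) : ℝ :=
  ‖∑ l ∈ Finset.range i, (flipFlopOp F π l z - fullOp F z)‖

theorem sum_apply_eq_smul_fullOp (F : Fin n → E → E) (z : E) :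
    ∑ j, F j z = (n : ℝ) • fullOp F z := by
  rw [fullOp, smul_smul, mul_inv_cancel₀ (Nat.cast_ne_zero.2 (NeZero.ne n)), one_smul]

theorem sum_sub_fullOp (F : Fin n → E → E) (z : E) : ∑ j, (F j z - fullOp F z) = 0 := by
  rw [Finset.sum_sub_distrib, sum_apply_eq_smul_fullOp]
  simp [Nat.cast_smul_eq_nsmul]

theorem devNorm_nonneg (F : Fin n → E → E) (π : Equiv.Perm (Fin n)) (z : E) (i : ℕ) :
    0 ≤ devNorm F π z i := norm_nonneg _

/-- The deviations add up to zero over the epoch, so by the palindrome the first `2 n - i` of them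
sum to minus the sum of the first `i`. -/
theorem devNorm_reflect (F : Fin n → E → E) (π : Equiv.Perm (Fin n)) (z : E) {i : ℕ}
    (hi : i ≤ 2 * n) : devNorm F π z (2 * n - i) = devNorm F π z i := by
  rw [devNorm, sum_range_sub_of_palindrome (fun l hl => by rw [flipFlopOp_reflect F π hl]) hi,
    sum_flipFlopOp F π (fun G => G z - fullOp F z), sum_sub_fullOp, add_zero, zero_sub, norm_neg,
    devNorm]

theorem devNorm_eq_of_le (F : Fin n → E → E) (z : E) {i : ℕ} (hi : i ≤ n) :
    ∃ A : Finset (Fin n), A.card = i ∧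
      ∀ π, devNorm F π z i = ‖∑ m ∈ A, (F (π m) z - fullOp F z)‖ := by
  refine ⟨Finset.univ.map (Fin.castLEEmb hi), by simp, fun π => ?_⟩
  rw [devNorm, Finset.sum_map, Finset.sum_range]
  congr 1
  refine Finset.sum_congr rfl fun m _ => ?_
  rw [← flipFlopOp_of_lt F π]
  rfl

/-- Up to reflection, a partial sum over an epoch is one over its first half. -/
theorem devNorm_eq_norm_sum (F : Fin n → E → E) (z : E) {i : ℕ} (hi : i < 2 * n) :
    ∃ A : Finset (Fin n), ∀ π, devNorm F π z i = ‖∑ m ∈ A, (F (π m) z - fullOp F z)‖ := by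
  rcases le_total i n with h | h
  · obtain ⟨A, -, hA⟩ := devNorm_eq_of_le F z h
    exact ⟨A, hA⟩
  · obtain ⟨A, -, hA⟩ := devNorm_eq_of_le F z (i := 2 * n - i) (by omega)
    exact ⟨A, fun π => by rw [← hA π, devNorm_reflect F π z hi.le]⟩

variable {F : Fin n → E → E} {ρ σ : ℝ}

theorem HasComponentVariance.sum_le (hvar : HasComponentVariance F ρ σ) (z : E) :
    ∑ j, ‖F j z - fullOp F z‖ ^ 2 ≤ n * (ρ * ‖fullOp F z‖ + σ) ^ 2 := by
  have hn : (0 : ℝ) < n := by exact_mod_cast Nat.pos_of_ne_zero (NeZero.ne n)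
  exact (inv_mul_le_iff₀ hn).1 (hvar z)

theorem devNorm_le (hvar : HasComponentVariance F ρ σ) (hρ : 0 ≤ ρ) (hσ : 0 ≤ σ)
    (π : Equiv.Perm (Fin n)) (z : E) {i : ℕ} (hi : i < 2 * n) :
    devNorm F π z i ≤ n * (ρ * ‖fullOp F z‖ + σ) := by
  obtain ⟨A, hA⟩ := devNorm_eq_norm_sum F z hi
  have hs : 0 ≤ ρ * ‖fullOp F z‖ + σ := by positivity
  have h1 : ∑ j, ‖F j z - fullOp F z‖ ≤ n * (ρ * ‖fullOp F z‖ + σ) := by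
    refine abs_le_of_sq_le_sq' ?_ (by positivity) |>.2
    have h2 := sq_sum_le_card_mul_sum_sq (s := Finset.univ) (f := fun j => ‖F j z - fullOp F z‖)
    rw [Finset.card_univ, Fintype.card_fin] at h2
    calc _ ≤ _ := h2
      _ ≤ n * (n * (ρ * ‖fullOp F z‖ + σ) ^ 2) :=
          mul_le_mul_of_nonneg_left (hvar.sum_le z) (Nat.cast_nonneg n)
      _ = _ := by ring
  rw [hA]
  calc _ ≤ ∑ m ∈ A, ‖F (π m) z - fullOp F z‖ := norm_sum_le _ _
    _ ≤ ∑ m, ‖F (π m) z - fullOp F z‖ :=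
        Finset.sum_le_univ_sum_of_nonneg fun m => norm_nonneg _
    _ = ∑ j, ‖F j z - fullOp F z‖ := Equiv.sum_comp π fun j => ‖F j z - fullOp F z‖
    _ ≤ _ := h1

/-- Averaging gains a factor `n` over the square of the worst-case bound `devNorm_le`; this is the
source of `n⁵` instead of `n⁶` in the noise term. -/
theorem sum_perm_devNorm_sq_le (hvar : HasComponentVariance F ρ σ) (z : E) {i : ℕ}
    (hi : i < 2 * n) :
    ∑ π, devNorm F π z i ^ 2 ≤ n.factorial * (n * (ρ * ‖fullOp F z‖ + σ) ^ 2) := by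
  have hn : (0 : ℝ) < n := by exact_mod_cast Nat.pos_of_ne_zero (NeZero.ne n)
  obtain ⟨A, hA⟩ := devNorm_eq_norm_sum F z hi
  simp_rw [hA]
  have h1 := card_mul_sum_perm_norm_sum_sq_le (sum_sub_fullOp F z) A
  have h2 : (A.card : ℝ) ≤ n := by
    exact_mod_cast (Finset.card_le_univ A).trans_eq (Fintype.card_fin n)
  refine le_of_mul_le_mul_left (h1.trans ?_) hn
  gcongr
  exact hvar.sum_le z

end Deviation

/-! ### Cubic bounds on the within-epoch error. -/

section EpochError

variable {E : Type*} [NormedAddCommGroup E] [InnerProductSpace ℝ E] {n : ℕ} [NeZero n]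
  {F : Fin n → E → E} {L M ρ σ η : ℝ}

theorem norm_sum_flipFlopOp_le (F : Fin n → E → E) (π : Equiv.Perm (Fin n)) (z : E) {i : ℕ}
    (hi : i ≤ 2 * n) :
    ‖∑ l ∈ Finset.range i, flipFlopOp F π l z‖ ≤ 2 * n * ‖fullOp F z‖ + devNorm F π z i := by
  have h1 : ∑ l ∈ Finset.range i, flipFlopOp F π l z =
      (i : ℝ) • fullOp F z + ∑ l ∈ Finset.range i, (flipFlopOp F π l z - fullOp F z) := by
    rw [Finset.sum_sub_distrib, Finset.sum_const, Finset.card_range, ← Nat.cast_smul_eq_nsmul ℝ]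
    abel
  rw [h1]
  refine (norm_add_le _ _).trans (add_le_add ?_ le_rfl)
  rw [norm_smul, Real.norm_natCast]
  gcongr
  exact_mod_cast hi

theorem norm_midSum_flipFlopOp_le (F : Fin n → E → E) (π : Equiv.Perm (Fin n)) (z : E) {i : ℕ}
    (hi : i < 2 * n) :
    ‖midSum (flipFlopOp F π) z i‖ ≤
      2 * n * ‖fullOp F z‖ + (devNorm F π z i + devNorm F π z (i + 1)) / 2 := by
  rw [midSum, norm_smul, Real.norm_of_nonneg (by norm_num)]
  have h1 := norm_add_le (∑ l ∈ Finset.range i, flipFlopOp F π l z)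
    (∑ l ∈ Finset.range (i + 1), flipFlopOp F π l z)
  linarith [norm_sum_flipFlopOp_le F π z hi.le, norm_sum_flipFlopOp_le F π z (i := i + 1) hi]

/-- Flip-flop sampling with anchoring agrees with the extragradient step to second order. -/
theorem epochError_epoch_eq (hF : ∀ i, IsSmoothOp L M (F i)) (π : Equiv.Perm (Fin n)) (z : E) :
    epochError F η z (epoch F π (η / 2) η z) =
      (1 / 2 : ℝ) • (innerIterate F π (η / 2) η z (2 * n) -
        (z - η • ∑ i ∈ Finset.range (2 * n), flipFlopOp F π i z +
          η ^ 2 • ∑ i ∈ Finset.range (2 * n),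
            fderiv ℝ (flipFlopOp F π i) z (midSum (flipFlopOp F π) z i))) +
      (η * n) • (fullOp F (z - (η * n) • fullOp F z) - fullOp F z -
        fderiv ℝ (fullOp F) z ((z - (η * n) • fullOp F z) - z)) := by
  have hD : ∑ j, fderiv ℝ (F j) z = (n : ℝ) • fderiv ℝ (fullOp F) z := by
    rw [fderiv_fullOp fun i => (hF i).differentiable, smul_smul,
      mul_inv_cancel₀ (Nat.cast_ne_zero.2 (NeZero.ne n)), one_smul]
  rw [sum_fderiv_midSum_of_palindrome (fun i hi => flipFlopOp_reflect F π hi),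
    sum_flipFlopOp F π (fun G => G z), sum_flipFlopOp F π (fun G => fderiv ℝ G z), hD,
    sum_apply_eq_smul_fullOp, sub_sub_cancel_left, map_neg, map_smul, ← two_smul ℝ, ← two_smul ℝ,
    smul_smul, smul_smul, smul_apply, map_smul, epochError, epoch]
  simp only [smul_apply, map_smul]
  module

theorem isSmoothOp_flipFlopOp (hF : ∀ i, IsSmoothOp L M (F i)) (π : Equiv.Perm (Fin n)) (i : ℕ) :
    IsSmoothOp L M (flipFlopOp F π i) := by
  unfold flipFlopOp
  split_ifs <;> exact hF _

/-- The deviations are left unevaluated so that both the worst-case bound and the average over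
permutations can be derived from here. -/
theorem norm_epochError_epoch_le (hL : 0 ≤ L) (hM : 0 ≤ M) (hη : 0 ≤ η)
    (hx : η * n * L ≤ 1 / 100) (hF : ∀ i, IsSmoothOp L M (F i)) (π : Equiv.Perm (Fin n)) (z : E) :
    ‖epochError F η z (epoch F π (η / 2) η z)‖ ≤
      η ^ 3 * (L ^ 2 * (6 * n ^ 3 * ‖fullOp F z‖ +
          2 * n * ∑ i ∈ Finset.range (2 * n), devNorm F π z i) +
        M * (28 * n ^ 3 * ‖fullOp F z‖ ^ 2 +
          8 * ∑ i ∈ Finset.range (2 * n), devNorm F π z i ^ 2)) := by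
  have hG := isSmoothOp_flipFlopOp hF π
  set G := flipFlopOp F π with hGdef
  set ζ := innerIterate F π (η / 2) η z with hζ
  have hz : ∀ i, ζ (i + 1) = segStep (η / 2) η (G i) (ζ i) := fun i => rfl
  have hz0 : ζ 0 = z := rfl
  set φ := ‖fullOp F z‖ with hφ
  set T := devNorm F π z with hT
  have hdisp := displacement_bounds (p := fun i => ‖halfStep η G ζ i - ζ 0‖)
    (q := fun i => ‖ζ i - ζ 0‖) (T := T) hη hL (norm_nonneg (fullOp F z)) hx
    (fun _ => norm_nonneg _) (fun _ => norm_nonneg _) (devNorm_nonneg F π z)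
    (by simpa using (devNorm_reflect F π z (i := 0) (by omega)))
    (fun i hi => (norm_iterate_sub_le hη hG hz i).trans (by
      gcongr; exact norm_sum_flipFlopOp_le F π z hi.le))
    (fun i hi => (norm_halfStep_sub_le hη hG hz i).trans (by
      gcongr; exact norm_midSum_flipFlopOp_le F π z hi))
  have hexp := norm_iterate_sub_expansion_le hη hL hM hG hz (2 * n)
  rw [hz0] at hexp hdisp
  have hsq : η * M * ∑ i ∈ Finset.range (2 * n), ‖halfStep η G ζ i - z‖ ^ 2 ≤
      η * M * (η ^ 2 * (54 * n ^ 3 * φ ^ 2 + 15 * ∑ i ∈ Finset.range (2 * n), T i ^ 2)) :=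
    mul_le_mul_of_nonneg_left hdisp.2 (by positivity)
  have hrem : ‖(η * n) • (fullOp F (z - (η * n) • fullOp F z) - fullOp F z -
      fderiv ℝ (fullOp F) z ((z - (η * n) • fullOp F z) - z))‖ ≤ η ^ 3 * (M * (n ^ 3 * φ ^ 2)) := by
    rw [norm_smul, Real.norm_of_nonneg (by positivity)]
    have h1 := (isSmoothOp_fullOp hF).taylor hM z (z - (η * n) • fullOp F z)
    have h2 : ‖z - (η * n) • fullOp F z - z‖ = η * n * φ := by
      rw [sub_sub_cancel_left, norm_neg, norm_smul, Real.norm_of_nonneg (by positivity)]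
    rw [h2] at h1
    calc _ ≤ η * n * (M * (η * n * φ) ^ 2) := mul_le_mul_of_nonneg_left h1 (by positivity)
      _ = _ := by ring
  have hpos : 0 ≤ η ^ 3 * (M * ∑ i ∈ Finset.range (2 * n), T i ^ 2) :=
    mul_nonneg (pow_nonneg hη 3) (mul_nonneg hM (Finset.sum_nonneg fun i _ => sq_nonneg _))
  rw [epochError_epoch_eq hF]
  refine (norm_add_le _ _).trans ?_
  rw [norm_smul (1 / 2 : ℝ), Real.norm_of_nonneg (by norm_num)]
  -- The remainder of the run is halved by anchoring, and the Taylor remainder of the deterministic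
  -- step is added: `28 = 54 / 2 + 1` and `8 ≥ 15 / 2`.
  linarith [hdisp.1]

theorem exp_two_ge : (7.38 : ℝ) ≤ Real.exp 2 := by
  have h1 := Real.exp_one_gt_d9
  have h2 : Real.exp 2 = Real.exp 1 ^ 2 := by rw [← Real.exp_nat_mul]; norm_num
  rw [h2]
  nlinarith

theorem exp_four_ge : (54 : ℝ) ≤ Real.exp 4 := by
  have h2 : Real.exp 4 = Real.exp 2 ^ 2 := by rw [← Real.exp_nat_mul]; norm_num
  rw [h2]
  nlinarith [exp_two_ge]

/-- The value `7` covers the coefficient `6` of the linear error term, and through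
`StepCond₁.mul_le` it also forces `η₀ n L ≤ 1/100`. -/
theorem seven_le_coeff :
    (7 : ℝ) ≤ 1 / 2 * (1 + 2 * Real.exp 2 / 3) + (6 + Real.exp 2) / 3 := by
  linarith [exp_two_ge]

/-- The deterministic bound on the within-epoch error of SEG-FFA. -/
theorem norm_epochError_epoch_le_cubic (hL : 0 ≤ L) (hM : 0 ≤ M) (hρ : 0 ≤ ρ) (hσ : 0 ≤ σ)
    (hη : 0 ≤ η) (hx : η * n * L ≤ 1 / 100) (hF : ∀ i, IsSmoothOp L M (F i))
    (hvar : HasComponentVariance F ρ σ) (π : Equiv.Perm (Fin n)) (z : E) :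
    ‖epochError F η z (epoch F π (η / 2) η z)‖ ≤
      η ^ 3 * (n : ℝ) ^ 3 * C1A L ρ * ‖fullOp F z‖
      + η ^ 3 * (n : ℝ) ^ 3 * D1A M ρ * ‖fullOp F z‖ ^ 2
      + η ^ 3 * (n : ℝ) ^ 3 * V1A L M σ := by
  refine (norm_epochError_epoch_le hL hM hη hx hF π z).trans ?_
  set φ := ‖fullOp F z‖ with hφ
  have hφ0 : 0 ≤ φ := norm_nonneg _
  set s := ρ * φ + σ with hs
  have hs0 : 0 ≤ s := by positivity
  have h1 : ∑ i ∈ Finset.range (2 * n), devNorm F π z i ≤ 2 * n ^ 2 * s := by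
    calc _ ≤ ∑ _i ∈ Finset.range (2 * n), n * s :=
          Finset.sum_le_sum fun i hi => devNorm_le hvar hρ hσ π z (Finset.mem_range.1 hi)
      _ = _ := by
          rw [Finset.sum_const, Finset.card_range, nsmul_eq_mul]; push_cast; ring
  have h2 : ∑ i ∈ Finset.range (2 * n), devNorm F π z i ^ 2 ≤ 2 * n ^ 3 * s ^ 2 := by
    calc _ ≤ ∑ _i ∈ Finset.range (2 * n), (n * s) ^ 2 :=
          Finset.sum_le_sum fun i hi => pow_le_pow_left₀ (norm_nonneg _)
            (devNorm_le hvar hρ hσ π z (Finset.mem_range.1 hi)) 2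
      _ = _ := by
          rw [Finset.sum_const, Finset.card_range, nsmul_eq_mul]; push_cast; ring
  have h3 : L ^ 2 * (6 * φ + 4 * s) ≤ C1A L ρ * φ + 15 * L ^ 2 * σ := by
    have : 6 * φ + 4 * s ≤ (1 / 2 * (1 + 2 * Real.exp 2 / 3) + (6 + Real.exp 2) / 3 + 15 * ρ) * φ +
        15 * σ := by
      have e1 := mul_le_mul_of_nonneg_right seven_le_coeff hφ0
      have e2 : 0 ≤ ρ * φ := by positivity
      rw [hs]; linarith
    calc _ ≤ _ := mul_le_mul_of_nonneg_left this (sq_nonneg L)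
      _ = _ := by rw [C1A]; ring
  have h4 : M * (28 * φ ^ 2 + 16 * s ^ 2) ≤
      D1A M ρ * φ ^ 2 + M * σ ^ 2 * (243 / 16 + 27 * Real.exp 4) := by
    have : 28 * φ ^ 2 + 16 * s ^ 2 ≤
        (83 / 4 + 24 * Real.exp 4 / 5 + ρ ^ 2 * (243 / 16 + 27 * Real.exp 4)) * φ ^ 2 +
        σ ^ 2 * (243 / 16 + 27 * Real.exp 4) := by
      have e0 : s ^ 2 ≤ 2 * (ρ ^ 2 * φ ^ 2 + σ ^ 2) := by
        rw [hs]; nlinarith [sq_nonneg (ρ * φ - σ)]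
      have e1 := mul_le_mul_of_nonneg_right exp_four_ge (sq_nonneg φ)
      have e2 := mul_le_mul_of_nonneg_right exp_four_ge (mul_nonneg (sq_nonneg ρ) (sq_nonneg φ))
      have e3 := mul_le_mul_of_nonneg_right exp_four_ge (sq_nonneg σ)
      have e4 := mul_nonneg (sq_nonneg ρ) (sq_nonneg φ)
      linarith [sq_nonneg φ, sq_nonneg σ]
    calc _ ≤ _ := mul_le_mul_of_nonneg_left this hM
      _ = _ := by rw [D1A]; ring
  calc _ ≤ η ^ 3 * (L ^ 2 * (6 * n ^ 3 * φ + 2 * n * (2 * n ^ 2 * s)) +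
        M * (28 * n ^ 3 * φ ^ 2 + 8 * (2 * n ^ 3 * s ^ 2))) := by gcongr
    _ = η ^ 3 * n ^ 3 * (L ^ 2 * (6 * φ + 4 * s) + M * (28 * φ ^ 2 + 16 * s ^ 2)) := by ring
    _ ≤ η ^ 3 * n ^ 3 * ((C1A L ρ * φ + 15 * L ^ 2 * σ) +
        (D1A M ρ * φ ^ 2 + M * σ ^ 2 * (243 / 16 + 27 * Real.exp 4))) := by gcongr
    _ = _ := by rw [V1A]; ring

/-- The bound on the second moment, over the drawn permutation, of the within-epoch error of
SEG-FFA. -/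
theorem sum_perm_norm_epochError_sq_le (hL : 0 ≤ L) (hM : 0 ≤ M) (hρ : 0 ≤ ρ) (hσ : 0 ≤ σ)
    (hη : 0 ≤ η) (hx : η * n * L ≤ 1 / 100) (hF : ∀ i, IsSmoothOp L M (F i))
    (hvar : HasComponentVariance F ρ σ) (z : E) :
    (n.factorial : ℝ)⁻¹ * ∑ π, ‖epochError F η z (epoch F π (η / 2) η z)‖ ^ 2 ≤
      η ^ 6 * (n : ℝ) ^ 6 * C2A L ρ * ‖fullOp F z‖ ^ 2
      + η ^ 6 * (n : ℝ) ^ 6 * D2A M ρ * ‖fullOp F z‖ ^ 4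
      + η ^ 6 * (n : ℝ) ^ 5 * V2A L M σ := by
  have hfac : (0 : ℝ) < n.factorial := by exact_mod_cast Nat.factorial_pos n
  have hn : (1 : ℝ) ≤ n := by exact_mod_cast Nat.one_le_iff_ne_zero.2 (NeZero.ne n)
  set φ := ‖fullOp F z‖ with hφ
  have hφ0 : 0 ≤ φ := norm_nonneg _
  set s := ρ * φ + σ with hs
  have hs0 : 0 ≤ s := by positivity
  set Q : Equiv.Perm (Fin n) → ℝ := fun π => ∑ i ∈ Finset.range (2 * n), devNorm F π z i ^ 2 with hQ
  have hQ0 : ∀ π, 0 ≤ Q π := fun π => Finset.sum_nonneg fun i _ => sq_nonneg _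
  have hQ1 : ∀ π, Q π ≤ 2 * n ^ 3 * s ^ 2 := fun π => by
    calc _ ≤ ∑ _i ∈ Finset.range (2 * n), (n * s) ^ 2 :=
          Finset.sum_le_sum fun i hi => pow_le_pow_left₀ (norm_nonneg _)
            (devNorm_le hvar hρ hσ π z (Finset.mem_range.1 hi)) 2
      _ = _ := by
          rw [Finset.sum_const, Finset.card_range, nsmul_eq_mul]; push_cast; ring
  have hQsum : ∑ π, Q π ≤ n.factorial * (2 * n ^ 2 * s ^ 2) := by
    rw [hQ, Finset.sum_comm]
    calc _ ≤ ∑ _i ∈ Finset.range (2 * n), n.factorial * (n * s ^ 2) :=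
          Finset.sum_le_sum fun i hi => sum_perm_devNorm_sq_le hvar z (Finset.mem_range.1 hi)
      _ = _ := by
          rw [Finset.sum_const, Finset.card_range, nsmul_eq_mul]; push_cast; ring
  have hpt : ∀ π, ‖epochError F η z (epoch F π (η / 2) η z)‖ ^ 2 ≤
      4 * η ^ 6 * (36 * L ^ 4 * n ^ 6 * φ ^ 2 + 784 * M ^ 2 * n ^ 6 * φ ^ 4 +
        (8 * L ^ 4 * n ^ 3 + 128 * M ^ 2 * n ^ 3 * s ^ 2) * Q π) := by
    intro π
    have h1 := norm_epochError_epoch_le hL hM hη hx hF π z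
    set A := ∑ i ∈ Finset.range (2 * n), devNorm F π z i with hA
    have hcs : A ^ 2 ≤ 2 * n * Q π := by
      have := sq_sum_le_card_mul_sum_sq (s := Finset.range (2 * n)) (f := devNorm F π z)
      rw [Finset.card_range] at this
      exact_mod_cast this
    -- One factor is bounded in the worst case and the other is kept, so that only a first moment of
    -- `Q` has to be averaged.
    have hQQ : Q π ^ 2 ≤ 2 * n ^ 3 * s ^ 2 * Q π := by
      rw [sq]; exact mul_le_mul_of_nonneg_right (hQ1 π) (hQ0 π)
    have h4 : ∀ a b c d : ℝ, (a + b + (c + d)) ^ 2 ≤ 4 * (a ^ 2 + b ^ 2 + c ^ 2 + d ^ 2) := by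
      intro a b c d
      linarith [sq_nonneg (a - b), sq_nonneg (a - c), sq_nonneg (a - d), sq_nonneg (b - c),
        sq_nonneg (b - d), sq_nonneg (c - d)]
    calc _ ≤ _ := pow_le_pow_left₀ (norm_nonneg _) h1 2
      _ = η ^ 6 * (L ^ 2 * (6 * n ^ 3 * φ) + L ^ 2 * (2 * n * A) +
          (M * (28 * n ^ 3 * φ ^ 2) + M * (8 * Q π))) ^ 2 := by ring
      _ ≤ η ^ 6 * (4 * ((L ^ 2 * (6 * n ^ 3 * φ)) ^ 2 + (L ^ 2 * (2 * n * A)) ^ 2 +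
          (M * (28 * n ^ 3 * φ ^ 2)) ^ 2 + (M * (8 * Q π)) ^ 2)) :=
          mul_le_mul_of_nonneg_left (h4 _ _ _ _) (by positivity)
      _ = 4 * η ^ 6 * (36 * L ^ 4 * n ^ 6 * φ ^ 2 + 784 * M ^ 2 * n ^ 6 * φ ^ 4 +
          (4 * L ^ 4 * n ^ 2 * A ^ 2 + 64 * M ^ 2 * Q π ^ 2)) := by ring
      _ ≤ 4 * η ^ 6 * (36 * L ^ 4 * n ^ 6 * φ ^ 2 + 784 * M ^ 2 * n ^ 6 * φ ^ 4 +
          (4 * L ^ 4 * n ^ 2 * (2 * n * Q π) + 64 * M ^ 2 * (2 * n ^ 3 * s ^ 2 * Q π))) := by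
          gcongr
      _ = _ := by ring
  have hs2 : s ^ 2 ≤ 2 * (ρ ^ 2 * φ ^ 2 + σ ^ 2) := by
    rw [hs]; nlinarith [sq_nonneg (ρ * φ - σ)]
  have hs4 : s ^ 4 ≤ 8 * (ρ ^ 4 * φ ^ 4 + σ ^ 4) := by
    calc s ^ 4 = (s ^ 2) ^ 2 := by ring
      _ ≤ (2 * (ρ ^ 2 * φ ^ 2 + σ ^ 2)) ^ 2 := pow_le_pow_left₀ (sq_nonneg s) hs2 2
      _ ≤ _ := by nlinarith [sq_nonneg (ρ ^ 2 * φ ^ 2 - σ ^ 2)]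
  -- The terms with `ρ` are weakened to `n ^ 6` to fit `C2A` and `D2A`; the terms with `σ` alone
  -- keep `n ^ 5`.
  have hn56 : (n : ℝ) ^ 5 ≤ n ^ 6 := pow_le_pow_right₀ hn (by norm_num)
  have h3 : 4 * (36 * L ^ 4 * n ^ 6 * φ ^ 2 + 32 * L ^ 4 * n ^ 5 * (ρ ^ 2 * φ ^ 2 + σ ^ 2)) ≤
      n ^ 6 * C2A L ρ * φ ^ 2 + n ^ 5 * (144 * Real.exp 4 * L ^ 4 * σ ^ 2) := by
    have e1 : (49 : ℝ) ≤ (1 / 2 * (1 + 2 * Real.exp 2 / 3) + (6 + Real.exp 2) / 3) ^ 2 := by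
      nlinarith [seven_le_coeff]
    calc _ ≤ 4 * (49 * (L ^ 4 * n ^ 6 * φ ^ 2) + 36 * 54 * (L ^ 4 * n ^ 6 * (ρ ^ 2 * φ ^ 2))) +
          144 * 54 * (L ^ 4 * n ^ 5 * σ ^ 2) := by
          have f1 : L ^ 4 * n ^ 5 * (ρ ^ 2 * φ ^ 2) ≤ L ^ 4 * n ^ 6 * (ρ ^ 2 * φ ^ 2) := by gcongr
          have f2 : 0 ≤ L ^ 4 * n ^ 5 * (ρ ^ 2 * φ ^ 2) := by positivity
          have f3 : 0 ≤ L ^ 4 * n ^ 6 * φ ^ 2 := by positivity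
          have f4 : 0 ≤ L ^ 4 * n ^ 5 * σ ^ 2 := by positivity
          linarith
      _ ≤ 4 * ((1 / 2 * (1 + 2 * Real.exp 2 / 3) + (6 + Real.exp 2) / 3) ^ 2 *
            (L ^ 4 * n ^ 6 * φ ^ 2) + 36 * Real.exp 4 * (L ^ 4 * n ^ 6 * (ρ ^ 2 * φ ^ 2))) +
          144 * Real.exp 4 * (L ^ 4 * n ^ 5 * σ ^ 2) := by
          have := exp_four_ge
          gcongr
      _ = _ := by rw [C2A]; ring
  have h4 : 4 * (784 * M ^ 2 * n ^ 6 * φ ^ 4 + 256 * M ^ 2 * n ^ 5 * (8 * (ρ ^ 4 * φ ^ 4 + σ ^ 4))) ≤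
      n ^ 6 * D2A M ρ * φ ^ 4 + n ^ 5 * (4 * M ^ 2 * σ ^ 4 * (243 / 16 + 27 * Real.exp 4) ^ 2) := by
    have e1 : (784 : ℝ) ≤ (83 / 4 + 24 * Real.exp 4 / 5) ^ 2 := by
      nlinarith [exp_four_ge]
    have e2 : (2048 : ℝ) ≤ (243 / 16 + 27 * Real.exp 4) ^ 2 := by
      nlinarith [exp_four_ge]
    calc _ ≤ 4 * (784 * (M ^ 2 * n ^ 6 * φ ^ 4) + 2048 * (M ^ 2 * n ^ 6 * (ρ ^ 4 * φ ^ 4))) +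
          4 * (2048 * (M ^ 2 * n ^ 5 * σ ^ 4)) := by
          have f1 : M ^ 2 * n ^ 5 * (ρ ^ 4 * φ ^ 4) ≤ M ^ 2 * n ^ 6 * (ρ ^ 4 * φ ^ 4) := by gcongr
          linarith
      _ ≤ 4 * ((83 / 4 + 24 * Real.exp 4 / 5) ^ 2 * (M ^ 2 * n ^ 6 * φ ^ 4) +
            (243 / 16 + 27 * Real.exp 4) ^ 2 * (M ^ 2 * n ^ 6 * (ρ ^ 4 * φ ^ 4))) +
          4 * ((243 / 16 + 27 * Real.exp 4) ^ 2 * (M ^ 2 * n ^ 5 * σ ^ 4)) := by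
          gcongr
      _ = _ := by rw [D2A]; ring
  rw [inv_mul_le_iff₀ hfac]
  calc _ ≤ ∑ π, 4 * η ^ 6 * (36 * L ^ 4 * n ^ 6 * φ ^ 2 + 784 * M ^ 2 * n ^ 6 * φ ^ 4 +
        (8 * L ^ 4 * n ^ 3 + 128 * M ^ 2 * n ^ 3 * s ^ 2) * Q π) :=
        Finset.sum_le_sum fun π _ => hpt π
    _ = 4 * η ^ 6 * (n.factorial * (36 * L ^ 4 * n ^ 6 * φ ^ 2 + 784 * M ^ 2 * n ^ 6 * φ ^ 4) +
        (8 * L ^ 4 * n ^ 3 + 128 * M ^ 2 * n ^ 3 * s ^ 2) * ∑ π, Q π) := by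
        rw [← Finset.mul_sum, Finset.sum_add_distrib, ← Finset.mul_sum, Finset.sum_const,
          Finset.card_univ, Fintype.card_perm, Fintype.card_fin, nsmul_eq_mul]
    _ ≤ 4 * η ^ 6 * (n.factorial * (36 * L ^ 4 * n ^ 6 * φ ^ 2 + 784 * M ^ 2 * n ^ 6 * φ ^ 4) +
        (8 * L ^ 4 * n ^ 3 + 128 * M ^ 2 * n ^ 3 * s ^ 2) *
          (n.factorial * (2 * n ^ 2 * s ^ 2))) := by gcongr
    _ = n.factorial * (η ^ 6 * (4 * (36 * L ^ 4 * n ^ 6 * φ ^ 2 + 16 * L ^ 4 * n ^ 5 * s ^ 2) +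
        4 * (784 * M ^ 2 * n ^ 6 * φ ^ 4 + 256 * M ^ 2 * n ^ 5 * s ^ 4))) := by ring
    _ ≤ n.factorial * (η ^ 6 * (4 * (36 * L ^ 4 * n ^ 6 * φ ^ 2 +
          16 * L ^ 4 * n ^ 5 * (2 * (ρ ^ 2 * φ ^ 2 + σ ^ 2))) +
        4 * (784 * M ^ 2 * n ^ 6 * φ ^ 4 +
          256 * M ^ 2 * n ^ 5 * (8 * (ρ ^ 4 * φ ^ 4 + σ ^ 4))))) := by gcongr
    _ ≤ n.factorial * (η ^ 6 * ((n ^ 6 * C2A L ρ * φ ^ 2 +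
          n ^ 5 * (144 * Real.exp 4 * L ^ 4 * σ ^ 2)) + (n ^ 6 * D2A M ρ * φ ^ 4 +
          n ^ 5 * (4 * M ^ 2 * σ ^ 4 * (243 / 16 + 27 * Real.exp 4) ^ 2)))) := by
        refine mul_le_mul_of_nonneg_left (mul_le_mul_of_nonneg_left ?_ (by positivity)) hfac.le
        linarith
    _ = _ := by rw [V2A]; ring

end EpochError

/-! ### Sums of stepsizes and the smallness conditions. -/

section Stepsize

theorem cbrt_pow_three {x : ℝ} (hx : 0 ≤ x) : (x ^ (1 / 3 : ℝ)) ^ 3 = x := by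
  rw [← Real.rpow_natCast, ← Real.rpow_mul hx]; norm_num

theorem log_natCast_add_two_pos (k : ℕ) : 0 < Real.log ((k : ℝ) + 2) :=
  Real.log_pos (by linarith [(Nat.cast_nonneg k : (0 : ℝ) ≤ k)])

theorem stepsize_pos {η₀ : ℝ} (h : 0 < η₀) (k : ℕ) : 0 < stepsize η₀ k := by
  have := log_natCast_add_two_pos k
  have := Real.log_pos one_lt_two
  unfold stepsize
  positivity

theorem stepsize_le {η₀ : ℝ} (h : 0 < η₀) (k : ℕ) : stepsize η₀ k ≤ η₀ := by
  have h1 := log_natCast_add_two_pos k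
  have h2 := Real.log_pos one_lt_two
  have hk : (2 : ℝ) ≤ (k : ℝ) + 2 := by linarith [(Nat.cast_nonneg k : (0 : ℝ) ≤ k)]
  unfold stepsize
  rw [div_le_iff₀ (by positivity), mul_assoc]
  gcongr

/-- The cubes of the stepsizes, normalised to `1` at `k = 0`. -/
def cubeWeight (k : ℕ) : ℝ := 2 * Real.log 2 ^ 3 / (((k : ℝ) + 2) * Real.log ((k : ℝ) + 2) ^ 3)

theorem stepsize_pow_three (η₀ : ℝ) (k : ℕ) : stepsize η₀ k ^ 3 = η₀ ^ 3 * cubeWeight k := by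
  rw [stepsize, cubeWeight, div_pow, mul_pow, mul_pow, mul_pow, cbrt_pow_three (by norm_num),
    cbrt_pow_three (by positivity)]
  ring

theorem cubeWeight_nonneg (k : ℕ) : 0 ≤ cubeWeight k := by
  have h1 := log_natCast_add_two_pos k
  have h2 := Real.log_pos one_lt_two
  unfold cubeWeight
  positivity

/-- A telescoping form of the integral test: `-1 / log² x` is a primitive of `2 / (x log³ x)`. -/
theorem two_div_mul_log_cube_le {x : ℝ} (hx : 1 < x) :
    2 / ((x + 1) * Real.log (x + 1) ^ 3) ≤ 1 / Real.log x ^ 2 - 1 / Real.log (x + 1) ^ 2 := by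
  have hx0 : 0 < x := by linarith
  have ha : 0 < Real.log x := Real.log_pos hx
  have hab : Real.log x ≤ Real.log (x + 1) := Real.log_le_log hx0 (by linarith)
  have hb : 0 < Real.log (x + 1) := ha.trans_le hab
  have hd : 1 / (x + 1) ≤ Real.log (x + 1) - Real.log x := by
    have h1 := Real.log_le_sub_one_of_pos (show 0 < x / (x + 1) by positivity)
    rw [Real.log_div (by positivity) (by positivity)] at h1
    have h2 : x / (x + 1) - 1 = -(1 / (x + 1)) := by field_simp; ring
    linarith
  set a := Real.log x
  set b := Real.log (x + 1)
  have h1 : 1 / a ^ 2 - 1 / b ^ 2 = (b - a) * ((a + b) / (a ^ 2 * b ^ 2)) := by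
    field_simp; ring
  have h2 : 2 / b ^ 3 ≤ (a + b) / (a ^ 2 * b ^ 2) := by
    rw [div_le_div_iff₀ (by positivity) (by positivity)]
    have : 0 ≤ b ^ 2 * ((b - a) * (b + 2 * a)) :=
      mul_nonneg (sq_nonneg b) (mul_nonneg (by linarith) (by linarith))
    linarith
  calc 2 / ((x + 1) * b ^ 3) = 1 / (x + 1) * (2 / b ^ 3) := by
        field_simp
    _ ≤ (b - a) * ((a + b) / (a ^ 2 * b ^ 2)) :=
        mul_le_mul hd h2 (by positivity) (by linarith)
    _ = _ := h1.symm

theorem sum_range_succ_cubeWeight_le (N : ℕ) :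
    ∑ k ∈ Finset.range (N + 1), cubeWeight k ≤
      1 + Real.log 2 ^ 3 * (1 / Real.log 2 ^ 2 - 1 / Real.log ((N : ℝ) + 2) ^ 2) := by
  have h2 := Real.log_pos one_lt_two
  induction N with
  | zero =>
    simp only [zero_add, Finset.range_one, Finset.sum_singleton, cubeWeight, CharP.cast_eq_zero,
      sub_self, mul_zero, add_zero]
    rw [div_self (by positivity)]
  | succ N ih =>
    rw [Finset.sum_range_succ]
    have h := mul_le_mul_of_nonneg_left (two_div_mul_log_cube_le (x := (N : ℝ) + 2)
      (by linarith [(Nat.cast_nonneg N : (0 : ℝ) ≤ N)])) (pow_nonneg h2.le 3)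
    have e : cubeWeight (N + 1) =
        Real.log 2 ^ 3 * (2 / (((N : ℝ) + 2 + 1) * Real.log ((N : ℝ) + 2 + 1) ^ 3)) := by
      rw [cubeWeight]; push_cast
      rw [show (N : ℝ) + 1 + 2 = N + 2 + 1 by ring]; ring
    rw [e]
    push_cast
    rw [show (N : ℝ) + 1 + 2 = N + 2 + 1 by ring]
    linarith

theorem sum_range_cubeWeight_le (N : ℕ) : ∑ k ∈ Finset.range N, cubeWeight k ≤ 2 := by
  have h2 := Real.log_pos one_lt_two
  have h3 : Real.log 2 ≤ 1 := by linarith [Real.log_le_sub_one_of_pos (zero_lt_two (α := ℝ))]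
  have h1 := sum_range_succ_cubeWeight_le N
  rw [Finset.sum_range_succ] at h1
  have h4 : Real.log 2 ^ 3 * (1 / Real.log 2 ^ 2) = Real.log 2 := by field_simp
  have h5 : 0 ≤ Real.log 2 ^ 3 * (1 / Real.log ((N : ℝ) + 2) ^ 2) := by positivity
  linarith [cubeWeight_nonneg N]

theorem summable_cubeWeight : Summable cubeWeight :=
  summable_of_sum_range_le cubeWeight_nonneg sum_range_cubeWeight_le

theorem tsum_cubeWeight_le : ∑' k, cubeWeight k ≤ 2 :=
  Real.tsum_le_of_sum_range_le cubeWeight_nonneg sum_range_cubeWeight_le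

theorem cubicSum_term_eq (n : ℕ) (L η₀ : ℝ) (k : ℕ) :
    stepsize η₀ k ^ 3 * (n : ℝ) ^ 3 * L ^ 3 = (η₀ * n * L) ^ 3 * cubeWeight k := by
  rw [stepsize_pow_three]; ring

theorem cubicSum_eq (n : ℕ) (L η₀ : ℝ) :
    cubicSum n L η₀ = (η₀ * n * L) ^ 3 * ∑' k, cubeWeight k := by
  rw [cubicSum, ← tsum_mul_left]
  exact tsum_congr fun k => cubicSum_term_eq n L η₀ k

theorem sum_range_le_cubicSum {n : ℕ} {L η₀ : ℝ} (hL : 0 ≤ L) (hη₀ : 0 ≤ η₀) (N : ℕ) :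
    ∑ k ∈ Finset.range N, stepsize η₀ k ^ 3 * (n : ℝ) ^ 3 * L ^ 3 ≤ cubicSum n L η₀ := by
  rw [cubicSum_eq, Finset.sum_congr rfl fun k _ => cubicSum_term_eq n L η₀ k, ← Finset.mul_sum]
  exact mul_le_mul_of_nonneg_left (summable_cubeWeight.sum_le_tsum _ fun k _ => cubeWeight_nonneg k)
    (by positivity)

theorem cubicSum_nonneg {n : ℕ} {L η₀ : ℝ} (hL : 0 ≤ L) (hη₀ : 0 ≤ η₀) :
    0 ≤ cubicSum n L η₀ := by
  simpa using sum_range_le_cubicSum hL hη₀ (n := n) 0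

/-- Far from sharp; `3/2` is the exponent that appears in `rateConst`. -/
theorem cubicSum_le {n : ℕ} {L η₀ : ℝ} (hL : 0 ≤ L) (hη₀ : 0 ≤ η₀) (hx : η₀ * n * L ≤ 1 / 100) :
    cubicSum n L η₀ ≤ 3 / 2 := by
  have h0 : 0 ≤ η₀ * n * L := by positivity
  have h1 : (η₀ * n * L) ^ 3 ≤ (1 / 100) ^ 3 := pow_le_pow_left₀ h0 hx 3
  rw [cubicSum_eq]
  calc _ ≤ (1 / 100 : ℝ) ^ 3 * 2 :=
        mul_le_mul h1 tsum_cubeWeight_le (tsum_nonneg cubeWeight_nonneg) (by norm_num)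
    _ ≤ _ := by norm_num

/-- `2 ^ 11 = 2048 ≤ 2187 = 3 ^ 7`. The ratio `11/7` is enough for the base case of
`cbrt_div_log_sq_le_sum`, as `12 ^ (1/3) ≤ (11/7) ^ 2`. -/
theorem seven_mul_log_three_ge : 11 * Real.log 2 ≤ 7 * Real.log 3 := by
  have h1 : Real.log ((2 : ℝ) ^ 11) ≤ Real.log ((3 : ℝ) ^ 7) :=
    Real.log_le_log (by norm_num) (by norm_num)
  rw [Real.log_pow, Real.log_pow] at h1
  exact_mod_cast h1

/-- The cube root grows by at most `x ^ (-2/3)` from `x` to `x + 1`, and the growth of the logarithm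
only lowers the left side. Up to a constant the summands are the squared stepsizes. -/
theorem cbrt_div_log_sq_le_sum (K : ℕ) :
    ((K : ℝ) + 3) ^ (1 / 3 : ℝ) / Real.log ((K : ℝ) + 3) ^ 2 ≤
      ∑ k ∈ Finset.range (K + 1),
        1 / ((((k : ℝ) + 2) ^ (1 / 3 : ℝ)) ^ 2 * Real.log ((k : ℝ) + 2) ^ 2) := by
  induction K with
  | zero =>
    simp only [CharP.cast_eq_zero, zero_add, Finset.range_one, Finset.sum_singleton]
    have h2 := Real.log_pos one_lt_two
    have h3 := seven_mul_log_three_ge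
    have hl3 : 0 < Real.log 3 := Real.log_pos (by norm_num)
    have e2 := cbrt_pow_three (x := 2) (by norm_num)
    have e3 := cbrt_pow_three (x := 3) (by norm_num)
    set a := (2 : ℝ) ^ (1 / 3 : ℝ) with ha
    set b := (3 : ℝ) ^ (1 / 3 : ℝ) with hb
    have ha0 : 0 < a := by positivity
    have hb0 : 0 < b := by positivity
    have hba : b * a ^ 2 ≤ 121 / 49 := by
      refine le_of_pow_le_pow_left₀ (n := 3) (by norm_num) (by norm_num) ?_
      have : (b * a ^ 2) ^ 3 = b ^ 3 * (a ^ 3) ^ 2 := by ring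
      rw [this, e2, e3]; norm_num
    rw [div_le_div_iff₀ (by positivity) (by positivity)]
    calc b * (a ^ 2 * Real.log 2 ^ 2) = (b * a ^ 2) * Real.log 2 ^ 2 := by ring
      _ ≤ 121 / 49 * Real.log 2 ^ 2 := by gcongr
      _ = (11 * Real.log 2) ^ 2 / 49 := by ring
      _ ≤ (7 * Real.log 3) ^ 2 / 49 := by gcongr
      _ = _ := by ring
  | succ K ih =>
    rw [Finset.sum_range_succ]
    push_cast
    rw [show (K : ℝ) + 1 + 3 = K + 3 + 1 by ring, show (K : ℝ) + 1 + 2 = K + 3 by ring]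
    have hx : (3 : ℝ) ≤ (K : ℝ) + 3 := by linarith [(Nat.cast_nonneg K : (0 : ℝ) ≤ K)]
    set x := (K : ℝ) + 3 with hxdef
    have hlx : 0 < Real.log x := Real.log_pos (by linarith)
    have hlog : Real.log x ≤ Real.log (x + 1) := Real.log_le_log (by linarith) (by linarith)
    have ea := cbrt_pow_three (x := x) (by linarith)
    have eb := cbrt_pow_three (x := x + 1) (by linarith)
    have ha0 : 0 < x ^ (1 / 3 : ℝ) := Real.rpow_pos_of_pos (by linarith) _
    have hab : x ^ (1 / 3 : ℝ) ≤ (x + 1) ^ (1 / 3 : ℝ) :=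
      Real.rpow_le_rpow (by linarith) (by linarith) (by norm_num)
    set a := x ^ (1 / 3 : ℝ)
    set b := (x + 1) ^ (1 / 3 : ℝ)
    have hb : b ≤ a + 1 / a ^ 2 := by
      rw [← sub_le_iff_le_add', le_div_iff₀ (by positivity)]
      have h1 : (b - a) * (b ^ 2 + a * b + a ^ 2) = 1 := by
        have : (b - a) * (b ^ 2 + a * b + a ^ 2) = b ^ 3 - a ^ 3 := by ring
        rw [this, ea, eb]; ring
      have h2 : 0 ≤ (b - a) * (b ^ 2 + a * b) := by
        have : 0 ≤ b - a := by linarith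
        have : 0 < b := by linarith
        positivity
      linarith
    calc b / Real.log (x + 1) ^ 2 ≤ b / Real.log x ^ 2 := by
          have : 0 < b := by linarith
          gcongr
      _ ≤ (a + 1 / a ^ 2) / Real.log x ^ 2 := by gcongr
      _ = a / Real.log x ^ 2 + 1 / (a ^ 2 * Real.log x ^ 2) := by rw [add_div, div_div]
      _ ≤ _ := by linarith

theorem stepsize_sq_sum_ge (η₀ : ℝ) (K : ℕ) :
    η₀ ^ 2 * ((2 : ℝ) ^ (1 / 3 : ℝ) * Real.log 2) ^ 2 *
      (((K : ℝ) + 3) ^ (1 / 3 : ℝ) / Real.log ((K : ℝ) + 3) ^ 2) ≤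
      ∑ k ∈ Finset.range (K + 1), stepsize η₀ k ^ 2 := by
  refine (mul_le_mul_of_nonneg_left (cbrt_div_log_sq_le_sum K) (by positivity)).trans_eq ?_
  rw [Finset.mul_sum]
  refine Finset.sum_congr rfl fun k _ => ?_
  rw [stepsize, div_pow, mul_pow, mul_pow, mul_pow, mul_pow]
  ring

theorem logSq_div_cbrt_isBigO :
    (fun K : ℕ => Real.log ((K : ℝ) + 3) ^ 2 / ((K : ℝ) + 3) ^ (1 / 3 : ℝ)) =O[atTop]
      fun K : ℕ => Real.log (K : ℝ) ^ 2 / (K : ℝ) ^ (1 / 3 : ℝ) := by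
  refine IsBigO.of_bound 4 ?_
  filter_upwards [eventually_ge_atTop 3] with K hK
  have hK3 : (3 : ℝ) ≤ K := by exact_mod_cast hK
  have h1 : Real.log ((K : ℝ) + 3) ≤ 2 * Real.log K := by
    calc _ ≤ Real.log ((K : ℝ) ^ 2) := Real.log_le_log (by linarith) (by nlinarith)
      _ = _ := by rw [Real.log_pow]; norm_num
  have h0 : 0 ≤ Real.log ((K : ℝ) + 3) := Real.log_nonneg (by linarith)
  rw [Real.norm_of_nonneg (by positivity), Real.norm_of_nonneg (by positivity)]
  calc _ ≤ (2 * Real.log K) ^ 2 / (K : ℝ) ^ (1 / 3 : ℝ) := by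
        gcongr
        linarith
    _ = _ := by ring

/-! ### Smallness conditions -/

/-- Both left sides are continuous in `η₀`, including through `cubicSum`, and vanish at `0`; `lam`
is the slack in the second condition. -/
theorem exists_forall_stepCond {n : ℕ} (L M ρ σ Δ : ℝ) :
    ∃ ηmax : ℝ, 0 < ηmax ∧ ∀ η₀ : ℝ, 0 < η₀ → η₀ ≤ ηmax →
      StepCond₁ n L M ρ σ η₀ Δ ∧ ∃ lam : ℝ, 0 < lam ∧ StepCond₂ n L M ρ σ η₀ Δ lam := by
  have hS : Continuous fun η₀ : ℝ => cubicSum n L η₀ := by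
    simp_rw [cubicSum_eq]; fun_prop
  have hR : Continuous fun η₀ : ℝ => radiusSq n L M σ η₀ Δ := by
    unfold radiusSq; fun_prop
  have h1 : ∀ᶠ η₀ in nhds (0 : ℝ), η₀ ^ 2 * (n : ℝ) ^ 2 * L ^ 2 + 3 * η₀ * n * C1A L ρ ^ 2 / L ^ 3
      + 3 * η₀ * n * D1A M ρ ^ 2 / L * radiusSq n L M σ η₀ Δ < 1 :=
    ContinuousAt.eventually_lt (by fun_prop) continuousAt_const (by simp)
  have h2 : ∀ᶠ η₀ in nhds (0 : ℝ), η₀ ^ 2 * (n : ℝ) ^ 2 * L ^ 2 + η₀ * n * C2A L ρ / L ^ 3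
      + η₀ * n * D2A M ρ / L * radiusSq n L M σ η₀ Δ < 1 :=
    ContinuousAt.eventually_lt (by fun_prop) continuousAt_const (by simp)
  obtain ⟨ε, hε, h⟩ := Metric.eventually_nhds_iff.1 (h1.and h2)
  refine ⟨ε / 2, by positivity, fun η₀ hη₀ hle => ?_⟩
  obtain ⟨h3, h4⟩ := h (y := η₀) (by rw [Real.dist_0_eq_abs, abs_of_pos hη₀]; linarith)
  exact ⟨h3.le, _, sub_pos.2 h4, by rw [StepCond₂, sub_sub_cancel]⟩

theorem radiusSq_nonneg {n : ℕ} {L M σ η₀ Δ : ℝ} (hL : 0 ≤ L) (hη₀ : 0 ≤ η₀) :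
    0 ≤ radiusSq n L M σ η₀ Δ := by
  have := cubicSum_nonneg (n := n) hL hη₀
  unfold radiusSq
  positivity

/-- The first smallness condition bounds the initial stepsize. -/
theorem StepCond₁.mul_le {n : ℕ} {L M ρ σ η₀ Δ : ℝ} (h : StepCond₁ n L M ρ σ η₀ Δ) (hL : 0 < L)
    (hρ : 0 ≤ ρ) (hη₀ : 0 < η₀) : η₀ * n * L ≤ 1 / 100 := by
  have hR := radiusSq_nonneg (n := n) (M := M) (σ := σ) (Δ := Δ) hL.le hη₀.le
  have h1 : (7 : ℝ) ≤ 1 / 2 * (1 + 2 * Real.exp 2 / 3) + (6 + Real.exp 2) / 3 + 15 * ρ := by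
    linarith [seven_le_coeff]
  have h2 : 3 * η₀ * n * C1A L ρ ^ 2 / L ^ 3 ≤ 1 := by
    have e1 : 0 ≤ η₀ ^ 2 * (n : ℝ) ^ 2 * L ^ 2 := by positivity
    have e2 : 0 ≤ 3 * η₀ * n * D1A M ρ ^ 2 / L * radiusSq n L M σ η₀ Δ := by positivity
    rw [StepCond₁] at h
    linarith
  have h3 : 3 * η₀ * n * C1A L ρ ^ 2 / L ^ 3 = 3 * (η₀ * n * L) *
      (1 / 2 * (1 + 2 * Real.exp 2 / 3) + (6 + Real.exp 2) / 3 + 15 * ρ) ^ 2 := by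
    rw [C1A]; field_simp
  -- `3 · 7 ^ 2 = 147`, which exceeds `100`.
  have h4 : 3 * (η₀ * n * L) * 7 ^ 2 ≤ 3 * η₀ * n * C1A L ρ ^ 2 / L ^ 3 := by
    rw [h3]; gcongr
  linarith

end Stepsize

/-! ### Perturbed descent recursions. -/

section Recursion

/-- A descent recursion with summable relative perturbations `γ k`. -/
theorem add_sum_le_of_perturbed_descent {u a γ : ℕ → ℝ} {v : ℝ} (hu : ∀ k, 0 ≤ u k)
    (ha : ∀ k, 0 ≤ a k) (hγ : ∀ k, 0 ≤ γ k) (hv : 0 ≤ v)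
    (h : ∀ k, u (k + 1) ≤ (1 + γ k) * (u k - a k + γ k * v)) (K : ℕ) :
    u K + ∑ k ∈ Finset.range K, a k ≤
      Real.exp (∑ k ∈ Finset.range K, γ k) * (u 0 + v * ∑ k ∈ Finset.range K, γ k) := by
  induction K with
  | zero => simp
  | succ K ih =>
    rw [Finset.sum_range_succ, Finset.sum_range_succ, Real.exp_add]
    set s := ∑ k ∈ Finset.range K, γ k
    set A := ∑ k ∈ Finset.range K, a k with hA
    have hA0 : 0 ≤ A := Finset.sum_nonneg fun k _ => ha k
    have hs0 : 0 ≤ s := Finset.sum_nonneg fun k _ => hγ k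
    have he : 1 + γ K ≤ Real.exp (γ K) := by linarith [Real.add_one_le_exp (γ K)]
    have he1 : 1 ≤ Real.exp (γ K) := by linarith [hγ K]
    have hes : 1 ≤ Real.exp s := by linarith [Real.add_one_le_exp s]
    -- Nonnegativity, forced by `0 ≤ u (K + 1)`, permits replacing `1 + γ K` by its exponential.
    have hX : 0 ≤ u K - a K + γ K * v := by
      by_contra! hlt
      linarith [h K, hu (K + 1), mul_neg_of_pos_of_neg (by linarith [hγ K] : 0 < 1 + γ K) hlt]
    have h1 : γ K * v ≤ Real.exp s * (γ K * v) :=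
      le_mul_of_one_le_left (mul_nonneg (hγ K) hv) hes
    calc u (K + 1) + (A + a K) ≤ Real.exp (γ K) * (u K - a K + γ K * v) + (A + a K) := by
          gcongr
          exact (h K).trans (mul_le_mul_of_nonneg_right he hX)
      _ ≤ Real.exp (γ K) * (u K - a K + γ K * v) + Real.exp (γ K) * (A + a K) := by
          gcongr
          exact le_mul_of_one_le_left (add_nonneg hA0 (ha K)) he1
      _ = Real.exp (γ K) * (u K + A + γ K * v) := by ring
      _ ≤ Real.exp (γ K) * (Real.exp s * (u 0 + v * s) + Real.exp s * (γ K * v)) := by gcongr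
      _ = _ := by ring

/-- The inductive step of the radius bound. There the descent at step `k` is available only once `z
k` is known to lie in the ball, so a recursion assumed for all `k` cannot be used. -/
theorem one_add_mul_le_exp_mul {γ s c d : ℝ} (hγ : 0 ≤ γ) (hs : 0 ≤ s) (hc : 0 ≤ c) (hd : 0 ≤ d) :
    (1 + γ) * (Real.exp s * (d + c * s) + c * γ) ≤
      Real.exp s * Real.exp γ * (d + c * (s + γ)) := by
  have hes : 1 ≤ Real.exp s := by linarith [Real.add_one_le_exp s]
  have heγ : 1 + γ ≤ Real.exp γ := by linarith [Real.add_one_le_exp γ]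
  have h9 : c * γ ≤ Real.exp s * (c * γ) := le_mul_of_one_le_left (mul_nonneg hc hγ) hes
  calc _ ≤ Real.exp γ * (Real.exp s * (d + c * s) + Real.exp s * (c * γ)) := by gcongr
    _ = _ := by ring

end Recursion

section ErrorBounds

variable {n : ℕ} {L M ρ σ η₀ : ℝ}

/-- The almost sure bound on the within-epoch error. -/
def errorBound (n : ℕ) (L M ρ σ η φ : ℝ) : ℝ :=
  η ^ 3 * (n : ℝ) ^ 3 * C1A L ρ * φ + η ^ 3 * (n : ℝ) ^ 3 * D1A M ρ * φ ^ 2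
    + η ^ 3 * (n : ℝ) ^ 3 * V1A L M σ

/-- The bound on the second moment of the within-epoch error. -/
def errorSqBound (n : ℕ) (L M ρ σ η φ : ℝ) : ℝ :=
  η ^ 6 * (n : ℝ) ^ 6 * C2A L ρ * φ ^ 2 + η ^ 6 * (n : ℝ) ^ 6 * D2A M ρ * φ ^ 4
    + η ^ 6 * (n : ℝ) ^ 5 * V2A L M σ

theorem sq_le_of_le_errorBound {η φ e : ℝ} (he : 0 ≤ e) (h : e ≤ errorBound n L M ρ σ η φ) :
    e ^ 2 ≤ 3 * (η ^ 6 * n ^ 6 * (C1A L ρ ^ 2 * φ ^ 2 + D1A M ρ ^ 2 * φ ^ 4 + V1A L M σ ^ 2)) := by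
  have h3 : ∀ a b c : ℝ, (a + b + c) ^ 2 ≤ 3 * (a ^ 2 + b ^ 2 + c ^ 2) := fun a b c => by
    linarith [sq_nonneg (a - b), sq_nonneg (a - c), sq_nonneg (b - c)]
  calc e ^ 2 ≤ _ := pow_le_pow_left₀ he h 2
    _ ≤ _ := h3 _ _ _
    _ = _ := by ring

/-- Monotonicity in `h = η n` passes the smallness conditions from `η₀` to every stepsize. -/
theorem stepCond_le_of_le {h h₀ c d : ℝ} (hh : 0 ≤ h) (hle : h ≤ h₀) (hc : 0 ≤ c) (hd : 0 ≤ d) :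
    h ^ 2 * L ^ 2 + h * c + h * d ≤ h₀ ^ 2 * L ^ 2 + h₀ * c + h₀ * d := by
  gcongr

theorem D2A_nonneg : 0 ≤ D2A M ρ := by unfold D2A; positivity

theorem C2A_nonneg : 0 ≤ C2A L ρ := by unfold C2A; positivity

theorem V2A_nonneg : 0 ≤ V2A L M σ := by unfold V2A; positivity

theorem StepCond₁.stepsize_le {Δ : ℝ} (h : StepCond₁ n L M ρ σ η₀ Δ) (hL : 0 < L) (hη₀ : 0 < η₀)
    (k : ℕ) :
    (stepsize η₀ k * n) ^ 2 * L ^ 2 + (stepsize η₀ k * n) * (3 * C1A L ρ ^ 2 / L ^ 3) +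
      (stepsize η₀ k * n) * (3 * D1A M ρ ^ 2 / L * radiusSq n L M σ η₀ Δ) ≤ 1 := by
  have hR := radiusSq_nonneg (n := n) (M := M) (σ := σ) (Δ := Δ) hL.le hη₀.le
  refine (stepCond_le_of_le (h₀ := η₀ * n) (mul_nonneg (stepsize_pos hη₀ k).le (Nat.cast_nonneg n))
    (mul_le_mul_of_nonneg_right (SEGFFA.stepsize_le hη₀ k) (Nat.cast_nonneg n)) (by positivity)
    (by positivity)).trans ?_
  rw [StepCond₁] at h
  refine le_trans (le_of_eq ?_) h
  ring

theorem StepCond₂.stepsize_le {Δ lam : ℝ} (h : StepCond₂ n L M ρ σ η₀ Δ lam) (hL : 0 < L)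
    (hη₀ : 0 < η₀) (k : ℕ) :
    (stepsize η₀ k * n) ^ 2 * L ^ 2 + (stepsize η₀ k * n) * (C2A L ρ / L ^ 3) +
      (stepsize η₀ k * n) * (D2A M ρ / L * radiusSq n L M σ η₀ Δ) ≤ 1 - lam := by
  have hR := radiusSq_nonneg (n := n) (M := M) (σ := σ) (Δ := Δ) hL.le hη₀.le
  have h1 := C2A_nonneg (L := L) (ρ := ρ)
  have h2 := D2A_nonneg (M := M) (ρ := ρ)
  refine (stepCond_le_of_le (h₀ := η₀ * n) (mul_nonneg (stepsize_pos hη₀ k).le (Nat.cast_nonneg n))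
    (mul_le_mul_of_nonneg_right (SEGFFA.stepsize_le hη₀ k) (Nat.cast_nonneg n)) (by positivity)
    (by positivity)).trans ?_
  rw [StepCond₂] at h
  refine le_trans (le_of_eq ?_) h
  ring

end ErrorBounds

/-! ### One-step descent and the almost sure radius. -/

section OneStep

variable {E : Type*} [NormedAddCommGroup E] [InnerProductSpace ℝ E] {n : ℕ} [NeZero n]
  {F : Fin n → E → E} {L M ρ σ η₀ : ℝ} {zs : E}

theorem natCast_pos_of_neZero : (0 : ℝ) < n := by exact_mod_cast Nat.pos_of_ne_zero (NeZero.ne n)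

/-- Extragradient descent combined with Young's inequality of weight `(η n L)³`, the order at which
both the growth factor and a squared cubic error divided by the weight are summable. -/
theorem norm_sub_sq_le_of_epochError {η : ℝ} (hη : 0 < η) (hL : 0 < L)
    (hF : ∀ i, IsSmoothOp L M (F i)) (hstar : IsStarMonotone (fullOp F) zs) (z z' : E) :
    ‖z' - zs‖ ^ 2 ≤ (1 + η ^ 3 * (n : ℝ) ^ 3 * L ^ 3) *
      (‖z - zs‖ ^ 2 - (η * n) ^ 2 * (1 - (η * n) ^ 2 * L ^ 2) * ‖fullOp F z‖ ^ 2 +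
        ‖epochError F η z z'‖ ^ 2 / (η ^ 3 * (n : ℝ) ^ 3 * L ^ 3)) := by
  have hn := natCast_pos_of_neZero (n := n)
  have h1 := extragradient_descent (h := η * n) (by positivity) (isSmoothOp_fullOp hF).lipschitz
    hstar z
  have h2 := norm_add_sq_le_of_pos (z - (η * n) • fullOp F (z - (η * n) • fullOp F z) - zs)
    (epochError F η z z') (γ := η ^ 3 * (n : ℝ) ^ 3 * L ^ 3) (by positivity)
  have h3 : z - (η * n) • fullOp F (z - (η * n) • fullOp F z) - zs + epochError F η z z' =
      z' - zs := by rw [epochError]; abel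
  rw [h3] at h2
  refine h2.trans (mul_le_mul_of_nonneg_left ?_ (by positivity))
  gcongr

theorem norm_fullOp_sq_le (hF : ∀ i, IsSmoothOp L M (F i)) (hzs : fullOp F zs = 0) (z : E) :
    ‖fullOp F z‖ ^ 2 ≤ L ^ 2 * ‖z - zs‖ ^ 2 := by
  have h := (isSmoothOp_fullOp hF).lipschitz z zs
  rw [hzs, sub_zero] at h
  rw [← mul_pow]
  exact pow_le_pow_left₀ (norm_nonneg _) h 2

/-- Under the deterministic error bound the iterates stay in a fixed ball around the zero. -/
theorem norm_sub_sq_le_radiusSq (hL : 0 < L) (hη₀ : 0 < η₀)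
    (hF : ∀ i, IsSmoothOp L M (F i)) (hzs : fullOp F zs = 0)
    (hstar : IsStarMonotone (fullOp F) zs) {z : ℕ → E}
    (hcond : StepCond₁ n L M ρ σ η₀ ‖z 0 - zs‖)
    (herr : ∀ k, ‖epochError F (stepsize η₀ k) (z k) (z (k + 1))‖ ≤
      errorBound n L M ρ σ (stepsize η₀ k) ‖fullOp F (z k)‖) (k : ℕ) :
    ‖z k - zs‖ ^ 2 ≤ radiusSq n L M σ η₀ ‖z 0 - zs‖ := by
  have hn := natCast_pos_of_neZero (n := n)
  have hγ : ∀ k, 0 < stepsize η₀ k ^ 3 * (n : ℝ) ^ 3 * L ^ 3 := fun k => by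
    have := stepsize_pos hη₀ k
    positivity
  set γ : ℕ → ℝ := fun k => stepsize η₀ k ^ 3 * (n : ℝ) ^ 3 * L ^ 3 with hγdef
  set c := 6 * V1A L M σ ^ 2 / L ^ 6 with hc
  have hc0 : 0 ≤ c := by positivity
  set R := radiusSq n L M σ η₀ ‖z 0 - zs‖ with hR
  have hle : ∀ k, Real.exp (∑ j ∈ Finset.range k, γ j) *
      (‖z 0 - zs‖ ^ 2 + c * ∑ j ∈ Finset.range k, γ j) ≤ R := by
    intro k
    have h1 : ∑ j ∈ Finset.range k, γ j ≤ cubicSum n L η₀ := sum_range_le_cubicSum hL.le hη₀.le k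
    have h2 : 0 ≤ ∑ j ∈ Finset.range k, γ j := Finset.sum_nonneg fun j _ => (hγ j).le
    calc _ ≤ Real.exp (cubicSum n L η₀) * (‖z 0 - zs‖ ^ 2 + c * cubicSum n L η₀) := by gcongr
      _ = _ := by rw [hR, radiusSq, hc]; ring
  suffices h : ‖z k - zs‖ ^ 2 ≤ Real.exp (∑ j ∈ Finset.range k, γ j) *
      (‖z 0 - zs‖ ^ 2 + c * ∑ j ∈ Finset.range k, γ j) from h.trans (hle k)
  induction k with
  | zero => simp
  | succ k ih =>
    have hd := ih.trans (hle k)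
    set φ := ‖fullOp F (z k)‖ with hφ
    have hφR : φ ^ 2 ≤ L ^ 2 * R := (norm_fullOp_sq_le hF hzs (z k)).trans (by gcongr)
    have hη := stepsize_pos hη₀ k
    have hcond' := hcond.stepsize_le hL hη₀ k
    have hstep := norm_sub_sq_le_of_epochError hη hL hF hstar (z k) (z (k + 1))
    have hesq := sq_le_of_le_errorBound (norm_nonneg _) (herr k)
    set h := stepsize η₀ k * n with hh
    have hh0 : 0 < h := by positivity
    have hγh : γ k = h ^ 3 * L ^ 3 := by rw [hγdef, hh]; ring
    have hsum0 : 0 ≤ ∑ j ∈ Finset.range k, γ j := Finset.sum_nonneg fun j _ => (hγ j).le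
    -- The quartic term is reduced by `φ ^ 2 ≤ L ^ 2 * R`, known from the induction hypothesis; the
    -- first smallness condition then fits the gradient terms into the descent. The noise costs only
    -- `c / 2 * γ k`.
    have h6 : ‖epochError F (stepsize η₀ k) (z k) (z (k + 1))‖ ^ 2 / γ k ≤
        h ^ 2 * (1 - h ^ 2 * L ^ 2) * φ ^ 2 + c * γ k := by
      have e1 : 3 * (stepsize η₀ k ^ 6 * n ^ 6 *
          (C1A L ρ ^ 2 * φ ^ 2 + D1A M ρ ^ 2 * φ ^ 4 + V1A L M σ ^ 2)) / γ k =
          h ^ 2 * φ ^ 2 * (h * (3 * C1A L ρ ^ 2 / L ^ 3)) +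
          h ^ 2 * φ ^ 2 * (h * (3 * D1A M ρ ^ 2 / L ^ 3 * φ ^ 2)) + c / 2 * γ k := by
        rw [hγh, hc, hh]; field_simp; ring
      have e2 : h ^ 2 * φ ^ 2 * (h * (3 * D1A M ρ ^ 2 / L ^ 3 * φ ^ 2)) ≤
          h ^ 2 * φ ^ 2 * (h * (3 * D1A M ρ ^ 2 / L ^ 3 * (L ^ 2 * R))) := by gcongr
      have e3 : 3 * D1A M ρ ^ 2 / L ^ 3 * (L ^ 2 * R) = 3 * D1A M ρ ^ 2 / L * R := by
        field_simp
      have e4 := mul_le_mul_of_nonneg_left hcond' (show 0 ≤ h ^ 2 * φ ^ 2 by positivity)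
      have e5 : 0 ≤ c * γ k := mul_nonneg hc0 (hγ k).le
      rw [e3] at e2
      have e6 := div_le_div_of_nonneg_right hesq (hγ k).le
      rw [e1] at e6
      linarith
    rw [Finset.sum_range_succ, Real.exp_add]
    refine le_trans ?_ (one_add_mul_le_exp_mul (hγ k).le hsum0 hc0 (sq_nonneg ‖z 0 - zs‖))
    refine hstep.trans (mul_le_mul_of_nonneg_left ?_ (add_nonneg zero_le_one (hγ k).le))
    linarith

theorem ae_norm_sub_sq_le_radiusSq {Ω : Type*} [MeasurableSpace Ω] {P : Measure Ω} {z : ℕ → Ω → E}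
    {z0 : E} (hL : 0 < L) (hη₀ : 0 < η₀)
    (hF : ∀ i, IsSmoothOp L M (F i)) (hzs : fullOp F zs = 0)
    (hstar : IsStarMonotone (fullOp F) zs) (hcond : StepCond₁ n L M ρ σ η₀ ‖z0 - zs‖)
    (hinit : ∀ᵐ ω ∂P, z 0 ω = z0)
    (herr : ∀ k, ∀ᵐ ω ∂P, ‖epochError F (stepsize η₀ k) (z k ω) (z (k + 1) ω)‖ ≤
      errorBound n L M ρ σ (stepsize η₀ k) ‖fullOp F (z k ω)‖) :
    ∀ᵐ ω ∂P, ∀ k, ‖z k ω - zs‖ ^ 2 ≤ radiusSq n L M σ η₀ ‖z0 - zs‖ := by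
  filter_upwards [hinit, ae_all_iff.2 herr] with ω h0 h k
  have := norm_sub_sq_le_radiusSq (z := fun k => z k ω) hL hη₀ hF hzs hstar
    (by rwa [h0]) h k
  rwa [h0] at this

theorem continuous_epochError (hF : ∀ i, IsSmoothOp L M (F i)) (η : ℝ) :
    Continuous fun x : E × E => epochError F η x.1 x.2 := by
  have := (isSmoothOp_fullOp hF).continuous
  unfold epochError
  fun_prop

theorem measurable_norm_fullOp [MeasurableSpace E] [BorelSpace E] {Ω : Type*} [MeasurableSpace Ω]
    (hF : ∀ i, IsSmoothOp L M (F i)) {z : Ω → E} (hz : Measurable z) :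
    Measurable fun ω => ‖fullOp F (z ω)‖ :=
  ((isSmoothOp_fullOp hF).continuous.norm.measurable).comp hz

end OneStep

theorem HasRate.of_bound {Ω E : Type*} [MeasurableSpace Ω] [NormedAddCommGroup E] {P : Measure Ω}
    {z : ℕ → Ω → E} {G : E → E} {c : ℝ}
    (hint : ∀ k, Integrable (fun ω => ‖G (z k ω)‖ ^ 2) P)
    (hbound : ∀ K : ℕ, minExpectedSqNorm P G z K ≤
      Real.log ((K : ℝ) + 3) ^ 2 / ((K : ℝ) + 3) ^ (1 / 3 : ℝ) * c) : HasRate P G c z where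
  integrable := hint
  bound K _ := hbound K
  isBigO := by
    refine IsBigO.trans (IsBigO.of_bound c (Eventually.of_forall fun K => ?_)) logSq_div_cbrt_isBigO
    have h0 : 0 ≤ minExpectedSqNorm P G z K :=
      Finset.le_inf' _ _ fun k _ => integral_nonneg fun ω => sq_nonneg _
    rw [Real.norm_of_nonneg h0, Real.norm_of_nonneg (by positivity), mul_comm]
    exact hbound K

/-! ### Descent in expectation and the rate. -/

section Expectation

variable {E : Type*} [NormedAddCommGroup E] [InnerProductSpace ℝ E]
  [MeasurableSpace E] [BorelSpace E] {n : ℕ} [NeZero n]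
  {F : Fin n → E → E} {L M ρ σ η₀ lam : ℝ} {zs z0 : E}
  {Ω : Type*} [MeasurableSpace Ω] {P : Measure Ω} [IsProbabilityMeasure P] {z : ℕ → Ω → E}

/-- Almost surely bounded iterates have integrable operator values and error bounds. -/
theorem integrable_of_radius (hF : ∀ i, IsSmoothOp L M (F i)) (hzs : fullOp F zs = 0) {R : ℝ}
    {z : Ω → E} (hz : Measurable z) (hR : ∀ᵐ ω ∂P, ‖z ω - zs‖ ^ 2 ≤ R) :
    Integrable (fun ω => ‖z ω - zs‖ ^ 2) P ∧ Integrable (fun ω => ‖fullOp F (z ω)‖ ^ 2) P ∧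
      Integrable (fun ω => ‖fullOp F (z ω)‖ ^ 4) P := by
  have hm := measurable_norm_fullOp hF hz
  refine ⟨Integrable.of_bound ((hz.sub_const zs).norm.pow_const 2).aestronglyMeasurable R ?_,
    Integrable.of_bound (hm.pow_const 2).aestronglyMeasurable (L ^ 2 * R) ?_,
    Integrable.of_bound (hm.pow_const 4).aestronglyMeasurable ((L ^ 2 * R) ^ 2) ?_⟩
  · filter_upwards [hR] with ω h
    rwa [Real.norm_of_nonneg (by positivity)]
  · filter_upwards [hR] with ω h
    rw [Real.norm_of_nonneg (by positivity)]
    exact (norm_fullOp_sq_le hF hzs _).trans (by gcongr)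
  · filter_upwards [hR] with ω h
    rw [Real.norm_of_nonneg (by positivity), show 4 = 2 * 2 by norm_num, pow_mul]
    exact pow_le_pow_left₀ (sq_nonneg _) ((norm_fullOp_sq_le hF hzs _).trans (by gcongr)) 2

theorem integrable_errorSqBound (hF : ∀ i, IsSmoothOp L M (F i)) (hzs : fullOp F zs = 0) {R : ℝ}
    {z : Ω → E} (hz : Measurable z) (hR : ∀ᵐ ω ∂P, ‖z ω - zs‖ ^ 2 ≤ R) (η : ℝ) :
    Integrable (fun ω => errorSqBound n L M ρ σ η ‖fullOp F (z ω)‖) P := by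
  obtain ⟨-, h2, h4⟩ := integrable_of_radius hF hzs hz hR
  exact ((h2.const_mul _).add (h4.const_mul _)).add (integrable_const _)

variable [FiniteDimensional ℝ E]

theorem measurable_norm_epochError (hF : ∀ i, IsSmoothOp L M (F i)) (η : ℝ) {z z' : Ω → E}
    (hz : Measurable z) (hz' : Measurable z') :
    Measurable fun ω => ‖epochError F η (z ω) (z' ω)‖ :=
  (continuous_epochError hF η).norm.measurable.comp (hz.prodMk hz')

theorem integrable_epochError_sq (hF : ∀ i, IsSmoothOp L M (F i)) (hzs : fullOp F zs = 0) {R : ℝ}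
    {z z' : Ω → E} (hz : Measurable z) (hz' : Measurable z') (hR : ∀ᵐ ω ∂P, ‖z ω - zs‖ ^ 2 ≤ R)
    {η : ℝ} (herr : ∀ᵐ ω ∂P, ‖epochError F η (z ω) (z' ω)‖ ≤
      errorBound n L M ρ σ η ‖fullOp F (z ω)‖) :
    Integrable (fun ω => ‖epochError F η (z ω) (z' ω)‖ ^ 2) P := by
  obtain ⟨-, h2, h4⟩ := integrable_of_radius hF hzs hz hR
  refine Integrable.mono' (((((h2.const_mul (C1A L ρ ^ 2)).add
    (h4.const_mul (D1A M ρ ^ 2))).add (integrable_const (V1A L M σ ^ 2))).const_mul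
      (η ^ 6 * (n : ℝ) ^ 6)).const_mul 3)
    ((measurable_norm_epochError hF η hz hz').pow_const 2).aestronglyMeasurable ?_
  filter_upwards [herr] with ω h
  rw [Real.norm_of_nonneg (by positivity)]
  exact sq_le_of_le_errorBound (norm_nonneg _) h

/-- The almost sure radius bounds the fourth moment of the operator norm by `L² R` times the second.
The second smallness condition then leaves the fraction `lam` of the descent. -/
theorem integral_norm_sub_sq_le (hL : 0 < L) (hη₀ : 0 < η₀)
    (hF : ∀ i, IsSmoothOp L M (F i)) (hzs : fullOp F zs = 0)
    (hstar : IsStarMonotone (fullOp F) zs) {Δ : ℝ}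
    (hcond : StepCond₂ n L M ρ σ η₀ Δ lam) (hmeas : ∀ k, Measurable (z k))
    (hR : ∀ᵐ ω ∂P, ∀ k, ‖z k ω - zs‖ ^ 2 ≤ radiusSq n L M σ η₀ Δ)
    (herr : ∀ k, ∀ᵐ ω ∂P, ‖epochError F (stepsize η₀ k) (z k ω) (z (k + 1) ω)‖ ≤
      errorBound n L M ρ σ (stepsize η₀ k) ‖fullOp F (z k ω)‖)
    (hint : ∀ k, ∫ ω, ‖epochError F (stepsize η₀ k) (z k ω) (z (k + 1) ω)‖ ^ 2 ∂P ≤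
      ∫ ω, errorSqBound n L M ρ σ (stepsize η₀ k) ‖fullOp F (z k ω)‖ ∂P) (k : ℕ) :
    ∫ ω, ‖z (k + 1) ω - zs‖ ^ 2 ∂P ≤ (1 + stepsize η₀ k ^ 3 * (n : ℝ) ^ 3 * L ^ 3) *
      (∫ ω, ‖z k ω - zs‖ ^ 2 ∂P -
        lam * (stepsize η₀ k * n) ^ 2 * ∫ ω, ‖fullOp F (z k ω)‖ ^ 2 ∂P +
        stepsize η₀ k ^ 3 * (n : ℝ) ^ 3 * L ^ 3 * (V2A L M σ / (n * L ^ 6))) := by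
  have hn := natCast_pos_of_neZero (n := n)
  have hR' : ∀ k, ∀ᵐ ω ∂P, ‖z k ω - zs‖ ^ 2 ≤ radiusSq n L M σ η₀ Δ := ae_all_iff.1 hR
  obtain ⟨hd, h2, h4⟩ := integrable_of_radius hF hzs (hmeas k) (hR' k)
  have hd' := (integrable_of_radius hF hzs (hmeas (k + 1)) (hR' (k + 1))).1
  have he := integrable_epochError_sq hF hzs (hmeas k) (hmeas (k + 1)) (hR' k) (herr k)
  have hη := stepsize_pos hη₀ k
  have hcond' := hcond.stepsize_le hL hη₀ k
  set R := radiusSq n L M σ η₀ Δ with hRdef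
  set γ := stepsize η₀ k ^ 3 * (n : ℝ) ^ 3 * L ^ 3 with hγdef
  have hγ : 0 < γ := by positivity
  set h := stepsize η₀ k * n with hh
  have hh0 : 0 < h := by positivity
  have hγh : γ = h ^ 3 * L ^ 3 := by rw [hγdef, hh]; ring
  have hstep : ∫ ω, ‖z (k + 1) ω - zs‖ ^ 2 ∂P ≤ (1 + γ) *
      (∫ ω, ‖z k ω - zs‖ ^ 2 ∂P - h ^ 2 * (1 - h ^ 2 * L ^ 2) * ∫ ω, ‖fullOp F (z k ω)‖ ^ 2 ∂P +
        (∫ ω, ‖epochError F (stepsize η₀ k) (z k ω) (z (k + 1) ω)‖ ^ 2 ∂P) / γ) := by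
    have i1 : Integrable (fun ω => ‖z k ω - zs‖ ^ 2 -
      h ^ 2 * (1 - h ^ 2 * L ^ 2) * ‖fullOp F (z k ω)‖ ^ 2) P := hd.sub (h2.const_mul _)
    rw [← integral_const_mul, ← integral_div, ← integral_sub hd (h2.const_mul _),
      ← integral_add i1 (he.div_const _), ← integral_const_mul]
    exact integral_mono hd' ((i1.add (he.div_const _)).const_mul _)
      fun ω => norm_sub_sq_le_of_epochError hη hL hF hstar (z k ω) (z (k + 1) ω)
  have h4le : ∫ ω, ‖fullOp F (z k ω)‖ ^ 4 ∂P ≤ L ^ 2 * R * ∫ ω, ‖fullOp F (z k ω)‖ ^ 2 ∂P := by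
    rw [← integral_const_mul]
    refine integral_mono_ae h4 (h2.const_mul _) ?_
    filter_upwards [hR' k] with ω hω
    rw [show 4 = 2 + 2 by norm_num, pow_add]
    exact mul_le_mul_of_nonneg_right ((norm_fullOp_sq_le hF hzs _).trans (by gcongr)) (sq_nonneg _)
  have hB : ∫ ω, errorSqBound n L M ρ σ (stepsize η₀ k) ‖fullOp F (z k ω)‖ ∂P =
      stepsize η₀ k ^ 6 * (n : ℝ) ^ 6 * C2A L ρ * ∫ ω, ‖fullOp F (z k ω)‖ ^ 2 ∂P +
      stepsize η₀ k ^ 6 * (n : ℝ) ^ 6 * D2A M ρ * ∫ ω, ‖fullOp F (z k ω)‖ ^ 4 ∂P +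
      stepsize η₀ k ^ 6 * (n : ℝ) ^ 5 * V2A L M σ := by
    simp only [errorSqBound]
    have i1 : Integrable (fun ω => stepsize η₀ k ^ 6 * (n : ℝ) ^ 6 * C2A L ρ *
      ‖fullOp F (z k ω)‖ ^ 2 + stepsize η₀ k ^ 6 * (n : ℝ) ^ 6 * D2A M ρ *
        ‖fullOp F (z k ω)‖ ^ 4) P := (h2.const_mul _).add (h4.const_mul _)
    rw [integral_add i1 (integrable_const _),
      integral_add (h2.const_mul _) (h4.const_mul _), integral_const_mul, integral_const_mul]
    simp
  have hE := (hint k).trans_eq hB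
  set g := ∫ ω, ‖fullOp F (z k ω)‖ ^ 2 ∂P with hg
  have hg0 : 0 ≤ g := integral_nonneg fun ω => sq_nonneg _
  set e := ∫ ω, ‖epochError F (stepsize η₀ k) (z k ω) (z (k + 1) ω)‖ ^ 2 ∂P
  have hD := D2A_nonneg (M := M) (ρ := ρ)
  have he1 : e / γ ≤ h ^ 2 * (1 - h ^ 2 * L ^ 2 - lam) * g + γ * (V2A L M σ / (n * L ^ 6)) := by
    have e1 : e ≤ stepsize η₀ k ^ 6 * (n : ℝ) ^ 6 * C2A L ρ * g +
        stepsize η₀ k ^ 6 * (n : ℝ) ^ 6 * D2A M ρ * (L ^ 2 * R * g) +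
        stepsize η₀ k ^ 6 * (n : ℝ) ^ 5 * V2A L M σ := hE.trans (by gcongr)
    have e2 := div_le_div_of_nonneg_right e1 hγ.le
    have e3 : (stepsize η₀ k ^ 6 * (n : ℝ) ^ 6 * C2A L ρ * g +
        stepsize η₀ k ^ 6 * (n : ℝ) ^ 6 * D2A M ρ * (L ^ 2 * R * g) +
        stepsize η₀ k ^ 6 * (n : ℝ) ^ 5 * V2A L M σ) / γ =
        h ^ 2 * g * (h * (C2A L ρ / L ^ 3) + h * (D2A M ρ / L * R)) +
          γ * (V2A L M σ / (n * L ^ 6)) := by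
      rw [hγh, hh]; field_simp
    rw [e3] at e2
    have e4 := mul_le_mul_of_nonneg_left hcond' (show 0 ≤ h ^ 2 * g by positivity)
    linarith
  refine hstep.trans (mul_le_mul_of_nonneg_left ?_ (by linarith))
  linarith

/-- The rate for any method with an almost sure and a mean square cubic error bound. -/
theorem hasRate_of_integral_error_le (hL : 0 < L) (hρ : 0 ≤ ρ) (hη₀ : 0 < η₀) (hlam : 0 < lam)
    (hF : ∀ i, IsSmoothOp L M (F i)) (hzs : fullOp F zs = 0)
    (hstar : IsStarMonotone (fullOp F) zs)
    (hcond₁ : StepCond₁ n L M ρ σ η₀ ‖z0 - zs‖) (hcond₂ : StepCond₂ n L M ρ σ η₀ ‖z0 - zs‖ lam)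
    (hmeas : ∀ k, Measurable (z k)) (hinit : ∀ᵐ ω ∂P, z 0 ω = z0)
    (herr : ∀ k, ∀ᵐ ω ∂P, ‖epochError F (stepsize η₀ k) (z k ω) (z (k + 1) ω)‖ ≤
      errorBound n L M ρ σ (stepsize η₀ k) ‖fullOp F (z k ω)‖)
    (hint : ∀ k, ∫ ω, ‖epochError F (stepsize η₀ k) (z k ω) (z (k + 1) ω)‖ ^ 2 ∂P ≤
      ∫ ω, errorSqBound n L M ρ σ (stepsize η₀ k) ‖fullOp F (z k ω)‖ ∂P) :
    HasRate P (fullOp F) (rateConst n L M σ η₀ ‖z0 - zs‖ lam) z := by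
  have hn := natCast_pos_of_neZero (n := n)
  have hR := ae_norm_sub_sq_le_radiusSq hL hη₀ hF hzs hstar hcond₁ hinit herr
  refine HasRate.of_bound
    (fun k => (integrable_of_radius hF hzs (hmeas k) (ae_all_iff.1 hR k)).2.1) fun K => ?_
  set m := minExpectedSqNorm P (fullOp F) z K with hm
  have hm0 : 0 ≤ m := Finset.le_inf' _ _ fun k _ => integral_nonneg fun ω => sq_nonneg _
  have hmle : ∀ k ∈ Finset.range (K + 1), m ≤ ∫ ω, ‖fullOp F (z k ω)‖ ^ 2 ∂P := fun k hk =>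
    Finset.inf'_le _ hk
  have hv : 0 ≤ V2A L M σ / (n * L ^ 6) := div_nonneg V2A_nonneg (by positivity)
  set v := V2A L M σ / (n * L ^ 6) with hvdef
  have hγ : ∀ k, 0 ≤ stepsize η₀ k ^ 3 * (n : ℝ) ^ 3 * L ^ 3 := fun k => by
    have := stepsize_pos hη₀ k
    positivity
  have hrec := add_sum_le_of_perturbed_descent (u := fun k => ∫ ω, ‖z k ω - zs‖ ^ 2 ∂P)
    (a := fun k => lam * (stepsize η₀ k * n) ^ 2 * ∫ ω, ‖fullOp F (z k ω)‖ ^ 2 ∂P)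
    (γ := fun k => stepsize η₀ k ^ 3 * (n : ℝ) ^ 3 * L ^ 3)
    (v := v) (fun k => integral_nonneg fun ω => sq_nonneg _)
    (fun k => mul_nonneg (by positivity) (integral_nonneg fun ω => sq_nonneg _)) hγ hv
    (integral_norm_sub_sq_le hL hη₀ hF hzs hstar hcond₂ hmeas hR herr hint) (K + 1)
  have h0 : ∫ ω, ‖z 0 ω - zs‖ ^ 2 ∂P = ‖z0 - zs‖ ^ 2 := by
    rw [integral_congr_ae (g := fun _ => ‖z0 - zs‖ ^ 2)
      (hinit.mono fun ω h => by simp only [h])]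
    simp
  have hu : 0 ≤ ∫ ω, ‖z (K + 1) ω - zs‖ ^ 2 ∂P := integral_nonneg fun ω => sq_nonneg _
  have hS := (sum_range_le_cubicSum hL.le hη₀.le (n := n) (K + 1)).trans
    (cubicSum_le hL.le hη₀.le (hcond₁.mul_le hL hρ hη₀))
  have hS0 : 0 ≤ ∑ k ∈ Finset.range (K + 1), stepsize η₀ k ^ 3 * (n : ℝ) ^ 3 * L ^ 3 :=
    Finset.sum_nonneg fun k _ => hγ k
  rw [h0] at hrec
  set X := ((K : ℝ) + 3) ^ (1 / 3 : ℝ) / Real.log ((K : ℝ) + 3) ^ 2 with hX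
  have hK3 : (3 : ℝ) ≤ (K : ℝ) + 3 := by linarith [(Nat.cast_nonneg K : (0 : ℝ) ≤ K)]
  have hX0 : 0 < X := by
    have := Real.log_pos (show 1 < (K : ℝ) + 3 by linarith)
    positivity
  have hlog2 := Real.log_pos one_lt_two
  have hupper : ∑ k ∈ Finset.range (K + 1),
      lam * (stepsize η₀ k * n) ^ 2 * ∫ ω, ‖fullOp F (z k ω)‖ ^ 2 ∂P ≤
      Real.exp (3 / 2) * (‖z0 - zs‖ ^ 2 + 3 * v) := by
    calc _ ≤ _ := (le_add_of_nonneg_left hu).trans hrec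
      _ ≤ Real.exp (3 / 2) * (‖z0 - zs‖ ^ 2 + v * (3 / 2)) := by gcongr
      _ ≤ _ := by
          have : v * (3 / 2) ≤ 3 * v := by linarith
          gcongr
  have hlower : lam * n ^ 2 * m * (η₀ ^ 2 * ((2 : ℝ) ^ (1 / 3 : ℝ) * Real.log 2) ^ 2 * X) ≤
      ∑ k ∈ Finset.range (K + 1),
        lam * (stepsize η₀ k * n) ^ 2 * ∫ ω, ‖fullOp F (z k ω)‖ ^ 2 ∂P := by
    calc _ ≤ lam * n ^ 2 * m * ∑ k ∈ Finset.range (K + 1), stepsize η₀ k ^ 2 :=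
          mul_le_mul_of_nonneg_left (stepsize_sq_sum_ge η₀ K) (by positivity)
      _ = ∑ k ∈ Finset.range (K + 1), lam * (stepsize η₀ k * n) ^ 2 * m := by
          rw [Finset.mul_sum]; exact Finset.sum_congr rfl fun k _ => by ring
      _ ≤ _ := Finset.sum_le_sum fun k hk =>
          mul_le_mul_of_nonneg_left (hmle k hk) (by positivity)
  have hXinv : Real.log ((K : ℝ) + 3) ^ 2 / ((K : ℝ) + 3) ^ (1 / 3 : ℝ) = X⁻¹ := by
    rw [hX, inv_div]
  have hcv : 3 * V2A L M σ / (n * L ^ 6) = 3 * v := by rw [hvdef]; ring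
  rw [hXinv, rateConst, hcv, ← div_eq_inv_mul, div_div, le_div_iff₀ (by positivity), Real.exp_neg]
  have hfin := hlower.trans hupper
  rw [← inv_mul_le_iff₀ (Real.exp_pos _)] at hfin
  calc _ = _ := by ring
    _ ≤ _ := hfin

/-- The conditional bound is needed only after integration, by the tower property. -/
theorem IsCubicErrorMethod.hasRate (hL : 0 < L) (hρ : 0 ≤ ρ) (hη₀ : 0 < η₀) (hlam : 0 < lam)
    (hF : ∀ i, IsSmoothOp L M (F i)) (hzs : fullOp F zs = 0)
    (hstar : IsStarMonotone (fullOp F) zs)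
    (hcond₁ : StepCond₁ n L M ρ σ η₀ ‖z0 - zs‖) (hcond₂ : StepCond₂ n L M ρ σ η₀ ‖z0 - zs‖ lam)
    (hz : IsCubicErrorMethod P F L M ρ σ (stepsize η₀) z0 z) :
    HasRate P (fullOp F) (rateConst n L M σ η₀ ‖z0 - zs‖ lam) z := by
  have hR := ae_norm_sub_sq_le_radiusSq hL hη₀ hF hzs hstar hcond₁ hz.init hz.error_le
  refine hasRate_of_integral_error_le hL hρ hη₀ hlam hF hzs hstar hcond₁ hcond₂ hz.measurable
    hz.init hz.error_le fun k => ?_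
  rw [← integral_condExp (hz.measurable k).comap_le]
  exact integral_mono_ae integrable_condExp
    (integrable_errorSqBound hF hzs (hz.measurable k) (ae_all_iff.1 hR k) _)
    (hz.condExp_error_le k)

end Expectation

/-! ### Independent uniform permutations and SEG-FFA. -/

section Shuffle

variable {Ω : Type*} [MeasurableSpace Ω] {P : Measure Ω}

/-- The expectation of a function of `Z` and of an independent uniform variable `τ` on a finite
type. -/
theorem integral_comp_of_indepFun_of_uniform {E ι : Type*} [MeasurableSpace E] [Fintype ι]
    [MeasurableSpace ι] [DiscreteMeasurableSpace ι] {Z : Ω → E} {τ : Ω → ι}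
    (hτ : Measurable τ) (hind : IndepFun Z τ P) {p : ENNReal} (hp : ∀ i, P (τ ⁻¹' {i}) = p)
    {g : ι → E → ℝ} (hg : ∀ i, Measurable (g i)) (hint : ∀ i, Integrable (fun ω => g i (Z ω)) P) :
    ∫ ω, g (τ ω) (Z ω) ∂P = ∫ ω, p.toReal * ∑ i, g i (Z ω) ∂P := by
  classical
  have hsets : ∀ i, MeasurableSet (τ ⁻¹' {i}) := fun i => hτ (MeasurableSet.of_discrete)
  have h1 : ∀ ω, g (τ ω) (Z ω) = ∑ i, (τ ⁻¹' {i}).indicator (fun ω => g i (Z ω)) ω := by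
    intro ω
    rw [Finset.sum_eq_single (τ ω)]
    · simp
    · intro i _ hi
      exact Set.indicator_of_notMem (fun h => hi h.symm) _
    · simp
  have h2 : ∀ i, ∫ ω, (τ ⁻¹' {i}).indicator (fun ω => g i (Z ω)) ω ∂P =
      p.toReal * ∫ ω, g i (Z ω) ∂P := by
    intro i
    have hm : Measurable (({i} : Set ι).indicator (fun _ => (1 : ℝ))) := Measurable.of_discrete
    have h3 := (hind.comp (hg i) hm).integral_fun_mul_eq_mul_integral
      (hint i).aestronglyMeasurable (hm.comp hτ).aestronglyMeasurable
    have h4 : ∫ ω, ({i} : Set ι).indicator (fun _ => (1 : ℝ)) (τ ω) ∂P = p.toReal := by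
      have : (fun ω => ({i} : Set ι).indicator (fun _ => (1 : ℝ)) (τ ω)) =
          (τ ⁻¹' {i}).indicator (fun _ => (1 : ℝ)) := rfl
      rw [this, integral_indicator_const _ (hsets i), Measure.real, hp i, smul_eq_mul, mul_one]
    simp only [Function.comp_apply] at h3
    rw [h4] at h3
    rw [mul_comm, ← h3]
    refine integral_congr_ae (Eventually.of_forall fun ω => ?_)
    by_cases h : τ ω = i <;> simp [h]
  simp_rw [h1]
  rw [integral_finsetSum _ fun i _ => (hint i).indicator (hsets i), integral_const_mul,
    integral_finsetSum _ fun i _ => hint i, Finset.mul_sum]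
  exact Finset.sum_congr rfl fun i _ => h2 i

end Shuffle

section FFA

variable {E : Type*} [NormedAddCommGroup E] [InnerProductSpace ℝ E] {n : ℕ} [NeZero n]

theorem segFFA_congr (F : Fin n → E → E) (η : ℕ → ℝ) (z0 : E) {τ τ' : ℕ → Equiv.Perm (Fin n)}
    {k : ℕ} (h : ∀ j < k, τ j = τ' j) : segFFA F η z0 τ k = segFFA F η z0 τ' k := by
  induction k with
  | zero => rfl
  | succ k ih =>
    rw [segFFA, segFFA, ih fun j hj => h j (hj.trans k.lt_succ_self), h k k.lt_succ_self]

/-- The iterate `k` as a function of the first `k` permutations. -/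
def segFFAOfPrefix (F : Fin n → E → E) (η : ℕ → ℝ) (z0 : E) (k : ℕ)
    (t : Finset.range k → Equiv.Perm (Fin n)) : E :=
  -- The filler permutation `1` is never read: iterate `k` uses only indices below `k`.
  segFFA F η z0 (fun j => if h : j ∈ Finset.range k then t ⟨j, h⟩ else 1) k

theorem segFFA_eq_prefix (F : Fin n → E → E) (η : ℕ → ℝ) (z0 : E) (τ : ℕ → Equiv.Perm (Fin n))
    (k : ℕ) : segFFA F η z0 τ k = segFFAOfPrefix F η z0 k (fun j => τ j) :=
  segFFA_congr F η z0 fun j hj => by simp [hj]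

instance instDiscreteMeasurableSpacePerm (n : ℕ) : DiscreteMeasurableSpace (Equiv.Perm (Fin n)) :=
  ⟨fun _ => trivial⟩

variable [MeasurableSpace E] {Ω : Type*} [MeasurableSpace Ω] {P : Measure Ω}
  {τ : ℕ → Ω → Equiv.Perm (Fin n)}

theorem IsUniformShuffle.measurable_segFFA (hτ : IsUniformShuffle P τ) (F : Fin n → E → E)
    (η : ℕ → ℝ) (z0 : E) (k : ℕ) : Measurable fun ω => segFFA F η z0 (fun j => τ j ω) k := by
  simp_rw [segFFA_eq_prefix]
  exact (Measurable.of_discrete (f := segFFAOfPrefix F η z0 k)).comp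
    (measurable_pi_lambda _ fun j => hτ.measurable j)

/-- The iterate at the start of an epoch is independent of the permutation drawn in it. -/
theorem IsUniformShuffle.indepFun_segFFA (hτ : IsUniformShuffle P τ) (F : Fin n → E → E)
    (η : ℕ → ℝ) (z0 : E) (k : ℕ) :
    IndepFun (fun ω => segFFA F η z0 (fun j => τ j ω) k) (τ k) P := by
  have h := hτ.indep.indepFun_finset (Finset.range k) {k} (by simp) hτ.measurable
  have h2 := h.comp (φ := segFFAOfPrefix F η z0 k)
    (ψ := fun t : ({k} : Finset ℕ) → Equiv.Perm (Fin n) => t ⟨k, Finset.mem_singleton_self k⟩)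
    Measurable.of_discrete Measurable.of_discrete
  simp_rw [segFFA_eq_prefix]
  exact h2

variable [BorelSpace E] [FiniteDimensional ℝ E] [IsProbabilityMeasure P] {F : Fin n → E → E}
  {L M ρ σ η₀ lam : ℝ} {zs z0 : E}

/-- The error of epoch `k` is a function of the current iterate and of a permutation independent of
it, so its second moment is the mean of the average over all permutations. The almost sure bound
holds for every permutation. -/
theorem IsUniformShuffle.hasRate_segFFA (hτ : IsUniformShuffle P τ) (hL : 0 < L) (hM : 0 ≤ M)
    (hρ : 0 ≤ ρ) (hσ : 0 ≤ σ) (hη₀ : 0 < η₀) (hlam : 0 < lam)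
    (hF : ∀ i, IsSmoothOp L M (F i)) (hvar : HasComponentVariance F ρ σ) (hzs : fullOp F zs = 0)
    (hstar : IsStarMonotone (fullOp F) zs)
    (hcond₁ : StepCond₁ n L M ρ σ η₀ ‖z0 - zs‖)
    (hcond₂ : StepCond₂ n L M ρ σ η₀ ‖z0 - zs‖ lam) :
    HasRate P (fullOp F) (rateConst n L M σ η₀ ‖z0 - zs‖ lam)
      (fun k ω => segFFA F (stepsize η₀) z0 (fun j => τ j ω) k) := by
  have hx : ∀ k, stepsize η₀ k * n * L ≤ 1 / 100 := fun k => by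
    refine le_trans ?_ (hcond₁.mul_le hL hρ hη₀)
    have := stepsize_le hη₀ k
    gcongr
  have herr : ∀ k π z, ‖epochError F (stepsize η₀ k) z
      (epoch F π (stepsize η₀ k / 2) (stepsize η₀ k) z)‖ ≤
      errorBound n L M ρ σ (stepsize η₀ k) ‖fullOp F z‖ := fun k π z =>
    norm_epochError_epoch_le_cubic hL.le hM hρ hσ (stepsize_pos hη₀ k).le (hx k) hF hvar π z
  have hmeas := hτ.measurable_segFFA F (stepsize η₀) z0
  have hinit : ∀ᵐ ω ∂P, segFFA F (stepsize η₀) z0 (fun j => τ j ω) 0 = z0 :=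
    Eventually.of_forall fun _ => rfl
  have hR := ae_norm_sub_sq_le_radiusSq (z := fun k ω => segFFA F (stepsize η₀) z0
    (fun j => τ j ω) k) hL hη₀ hF hzs hstar hcond₁ hinit
    fun k => Eventually.of_forall fun ω => herr k (τ k ω) _
  refine hasRate_of_integral_error_le hL hρ hη₀ hlam hF hzs hstar hcond₁ hcond₂ hmeas hinit
    (fun k => Eventually.of_forall fun ω => herr k (τ k ω) _) fun k => ?_
  set η := stepsize η₀ k
  set Z : Ω → E := fun ω => segFFA F (stepsize η₀) z0 (fun j => τ j ω) k with hZ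
  have hcont : ∀ π, Continuous fun z => epoch F π (η / 2) η z := by
    intro π
    have h1 : ∀ i, Continuous fun z => innerIterate F π (η / 2) η z i := by
      intro i
      induction i with
      | zero => exact continuous_id
      | succ i ih =>
        have := (isSmoothOp_flipFlopOp hF π i).continuous
        simp only [innerIterate, segStep]
        fun_prop
    have := h1 (2 * n)
    unfold epoch
    fun_prop
  set g : Equiv.Perm (Fin n) → E → ℝ := fun π z =>
    ‖epochError F η z (epoch F π (η / 2) η z)‖ ^ 2 with hgdef
  have hg : ∀ π, Measurable (g π) := fun π =>
    (measurable_norm_epochError hF η measurable_id (hcont π).measurable).pow_const 2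
  have hgint : ∀ π, Integrable (fun ω => g π (Z ω)) P := fun π =>
    integrable_epochError_sq hF hzs (hmeas k) ((hcont π).measurable.comp (hmeas k))
      (ae_all_iff.1 hR k) (Eventually.of_forall fun ω => herr k π _)
  calc _ = ∫ ω, g (τ k ω) (Z ω) ∂P := rfl
    _ = ∫ ω, (((n.factorial : ℕ) : ENNReal)⁻¹).toReal * ∑ π, g π (Z ω) ∂P :=
        integral_comp_of_indepFun_of_uniform (hτ.measurable k)
          (hτ.indepFun_segFFA F (stepsize η₀) z0 k) (hτ.uniform k) hg hgint
    _ ≤ _ := by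
        refine integral_mono ((integrable_finsetSum _ fun π _ => hgint π).const_mul _)
          (integrable_errorSqBound hF hzs (hmeas k) (ae_all_iff.1 hR k) _) fun ω => ?_
        simp only [ENNReal.toReal_inv, ENNReal.toReal_natCast]
        exact sum_perm_norm_epochError_sq_le hL.le hM hρ hσ (stepsize_pos hη₀ k).le (hx k) hF hvar _

end FFA

end SEGFFA

end

open SEGFFA in
theorem mainTheorem1 {E : Type*} [NormedAddCommGroup E] [InnerProductSpace ℝ E]
    [FiniteDimensional ℝ E] [MeasurableSpace E] [BorelSpace E]
    {n : ℕ} [NeZero n] (F : Fin n → E → E) (L M ρ σ : ℝ)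
    (hL : 0 < L) (hM : 0 ≤ M) (hρ : 0 ≤ ρ) (hσ : 0 ≤ σ)
    (hF : ∀ i, IsSmoothOp L M (F i)) (hvar : HasComponentVariance F ρ σ)
    (zs : E) (hzs : fullOp F zs = 0) (hstar : IsStarMonotone (fullOp F) zs) (z0 : E) :
    -- all sufficiently small `η₀` are admissible
    (∃ ηmax : ℝ, 0 < ηmax ∧ ∀ η₀ : ℝ, 0 < η₀ → η₀ ≤ ηmax →
      StepCond₁ n L M ρ σ η₀ ‖z0 - zs‖ ∧
        ∃ lam : ℝ, 0 < lam ∧ StepCond₂ n L M ρ σ η₀ ‖z0 - zs‖ lam) ∧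
    -- every admissible `η₀` yields the rate
    (∀ η₀ lam : ℝ, 0 < η₀ → 0 < lam → StepCond₁ n L M ρ σ η₀ ‖z0 - zs‖ →
      StepCond₂ n L M ρ σ η₀ ‖z0 - zs‖ lam →
      ∀ {Ω : Type*} [MeasurableSpace Ω] (P : Measure Ω) [IsProbabilityMeasure P],
        -- for SEG-FFA
        (∀ τ : ℕ → Ω → Equiv.Perm (Fin n), IsUniformShuffle P τ →
          HasRate P (fullOp F) (rateConst n L M σ η₀ ‖z0 - zs‖ lam)
            (fun k ω => segFFA F (stepsize η₀) z0 (fun j => τ j ω) k)) ∧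
        -- for any method with the same within-epoch error bounds
        (∀ z : ℕ → Ω → E, IsCubicErrorMethod P F L M ρ σ (stepsize η₀) z0 z →
          HasRate P (fullOp F) (rateConst n L M σ η₀ ‖z0 - zs‖ lam) z)) := by
  refine ⟨exists_forall_stepCond L M ρ σ ‖z0 - zs‖,
    fun η₀ lam hη₀ hlam hcond₁ hcond₂ Ω _ P _ => ⟨fun τ hτ => ?_, fun z hz => ?_⟩⟩
  · exact hτ.hasRate_segFFA hL hM hρ hσ hη₀ hlam hF hvar hzs hstar hcond₁ hcond₂
  · exact hz.hasRate hL hρ hη₀ hlam hF hzs hstar hcond₁ hcond₂
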